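/- Let $\omega_a,\omega_b,\delta\in\mathbb R$ and $\kappa,\zeta_a,\zeta_b\in\mathbb C$, put $\eta=\omega_a+\omega_b+\delta$, and let $\varphi\in\mathbb C$ be a square root of $|\kappa|^2-(\delta/2)^2$, with $\varphi\neq0$. The parametric amplifier ($\hbar=1$) is the two-mode bosonic system with annihilation operators $\mathbf a,\mathbf b$ and Hamiltonian $$\mathbf H(t)=\omega_a\mathbf a^\dagger\mathbf a+\omega_b\mathbf b^\dagger\mathbf b+\kappa\,\mathbf a\mathbf b\,e^{i\eta t}+\kappa^*\mathbf a^\dagger\mathbf b^\dagger e^{-i\eta t}.$$ Write $|\alpha_a,\alpha_b\rangle$ for the two-mode coherent states. Then the Schrödinger equation $i\,\partial_t\psi=\mathbf H(t)\psi$, tested against number states, has exactly one norm-continuous solution $\psi:\mathbb R\to\ell^2(\mathbb N\times\mathbb N)$ in the two-mode Fock space with initial state $\psi(0)=|\zeta_a,\zeta_b\rangle$. Let $\rho(t)=|\psi(t)\rangle\langle\psi(t)|$, let $$\mathscr H(\alpha_a,\alpha_b;t)=\langle\alpha_a,\alpha_b|\rho(t)|\alpha_a,\alpha_b\rangle$$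 be its Husimi function, let $$\mathscr H^{(A)}(\alpha_a;t)=\int\mathscr H\,\frac{d^2\alpha_b}{\pi},\qquad \mathscr H^{(B)}(\alpha_b;t)=\int\mathscr H\,\frac{d^2\alpha_a}{\pi}$$ be the marginals, and define $$\mathrm E[\mathscr H;t]=-\int\frac{d^2\alpha_a\,d^2\alpha_b}{\pi^2}\,\mathscr H\ln\mathscr H,\qquad \mathrm E[\mathscr H^{(A,B)};t]=-\int\frac{d^2\alpha_{a,b}}{\pi}\,\mathscr H^{(A,B)}\ln\mathscr H^{(A,B)},$$ $$\mathrm C[\mathscr H;t]=2\left(1-\frac{\mathrm E[\mathscr H;t]}{\mathrm E[\mathscr H^{(A)};t]+\mathrm E[\mathscr H^{(B)};t]}\right).$$ Put $L(t)=\ln\bigl[1+(|\kappa|/\varphi)^2\sinh^2(\varphi t)\bigr]$. Then, for every $t\in\mathbb R$, all these integrals converge absolutely and $$\mathrm E[\mathscr H;t]=2+L(t),\qquad \mathrm E[\mathscr H^{(A)};t]=\mathrm E[\mathscr H^{(B)};t]=1+L(t),\qquad \mathrm C[\mathscr H;t]=\frac{L(t)}{1+L(t)}.$$ In particular $\mathrm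 C[\mathscr H;0]=0$, and if $|\delta|/2<|\kappa|$ (so that $\varphi$ is real) then $\mathrm C[\mathscr H;t]\to1$ as $t\to+\infty$. -/

import Mathlib

noncomputable section

namespace ParametricAmplifier

/-! ## Two-mode Fock space

A pure state is identified with its array of coefficients `c (m, n) = ⟨m, n | ψ⟩` in the orthonormal
basis of number states. -/

/-- The two-mode Fock space, in the number representation: square-summable arrays on `ℕ × ℕ`. -/
abbrev Fock : Type := lp (fun _ : ℕ × ℕ => ℂ) 2

/-- Annihilation operator of the signal mode, `a |m, n⟩ = √m |m - 1, n⟩`, in coefficients.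
Ladder operators are unbounded on `Fock`, so they act on all coefficient arrays. -/
def opA : Module.End ℂ (ℕ × ℕ → ℂ) where
  toFun c p := (Real.sqrt (p.1 + 1) : ℂ) * c (p.1 + 1, p.2)
  map_add' c d := by ext p; simp [mul_add]
  map_smul' r c := by ext p; simp [mul_left_comm]

/-- Creation operator of the signal mode, `a† |m, n⟩ = √(m + 1) |m + 1, n⟩`, in coefficients
(the entry at `m = 0` is `0`). -/
def opAdag : Module.End ℂ (ℕ × ℕ → ℂ) where
  toFun c p := (Real.sqrt p.1 : ℂ) * c (p.1 - 1, p.2)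
  map_add' c d := by ext p; simp [mul_add]
  map_smul' r c := by ext p; simp [mul_left_comm]

/-- Annihilation operator of the idler mode, `b |m, n⟩ = √n |m, n - 1⟩`, in coefficients. -/
def opB : Module.End ℂ (ℕ × ℕ → ℂ) where
  toFun c p := (Real.sqrt (p.2 + 1) : ℂ) * c (p.1, p.2 + 1)
  map_add' c d := by ext p; simp [mul_add]
  map_smul' r c := by ext p; simp [mul_left_comm]

/-- Creation operator of the idler mode, `b† |m, n⟩ = √(n + 1) |m, n + 1⟩`, in coefficients. -/
def opBdag : Module.End ℂ (ℕ × ℕ → ℂ) where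
  toFun c p := (Real.sqrt p.2 : ℂ) * c (p.1, p.2 - 1)
  map_add' c d := by ext p; simp [mul_add]
  map_smul' r c := by ext p; simp [mul_left_comm]

/-- Hamiltonian of the parametric amplifier (`ħ = 1`),
`H(t) = ωa a†a + ωb b†b + κ a b e^{iηt} + κ* a†b† e^{-iηt}`, with `η = ωa + ωb + δ`. -/
def hamiltonian (ωa ωb δ : ℝ) (κ : ℂ) (t : ℝ) : Module.End ℂ (ℕ × ℕ → ℂ) :=
  (ωa : ℂ) • (opAdag * opA) + (ωb : ℂ) • (opBdag * opB)
    + (κ * Complex.exp (Complex.I * ((ωa + ωb + δ : ℝ) : ℂ) * t)) • (opA * opB)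
    + (starRingEnd ℂ κ * Complex.exp (-(Complex.I * ((ωa + ωb + δ : ℝ) : ℂ) * t))) •
        (opAdag * opBdag)

/-- `ψ` is the evolution of the state vector `ψ₀` under the Hamiltonian: a norm-continuous curve in
Fock space with `ψ 0 = ψ₀` that solves `i dψ/dt = H(t) ψ`, the equation being tested against every
number state `|m, n⟩`. -/
structure IsEvolution (ωa ωb δ : ℝ) (κ : ℂ) (ψ₀ : Fock) (ψ : ℝ → Fock) : Prop where
  continuous : Continuous ψ
  initial : ψ 0 = ψ₀
  schrodinger : ∀ (t : ℝ) (p : ℕ × ℕ),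
    HasDerivAt (fun s : ℝ => (ψ s : ℕ × ℕ → ℂ) p)
      (-Complex.I * hamiltonian ωa ωb δ κ t (ψ t : ℕ × ℕ → ℂ) p) t

/-! ## Coherent states and the Husimi function -/

/-- The coefficient `⟨n | z⟩ = e^{-|z|²/2} zⁿ / √(n!)` of the one-mode coherent state `|z⟩`. -/
def coherentCoeff (z : ℂ) (n : ℕ) : ℂ :=
  (Real.exp (-‖z‖ ^ 2 / 2) : ℂ) * z ^ n / (Real.sqrt (n.factorial : ℝ) : ℂ)

theorem norm_coherentCoeff_sq (z : ℂ) (n : ℕ) :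
    ‖coherentCoeff z n‖ ^ 2
      = Real.exp (-‖z‖ ^ 2 / 2) ^ 2 * ((‖z‖ ^ 2) ^ n / (n.factorial : ℝ)) := by
  have h : (0 : ℝ) ≤ n.factorial := by positivity
  simp only [coherentCoeff, norm_div, norm_mul, norm_pow, Complex.norm_real, Real.norm_eq_abs,
    Real.abs_exp, abs_of_nonneg (Real.sqrt_nonneg _), div_pow, mul_pow, Real.sq_sqrt h]
  ring

theorem summable_coherentCoeff_sq (z : ℂ) : Summable fun n => ‖coherentCoeff z n‖ ^ 2 := by
  simp only [norm_coherentCoeff_sq]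
  exact (Real.summable_pow_div_factorial _).mul_left _

theorem memℓp_coherent (z w : ℂ) :
    Memℓp (fun p : ℕ × ℕ => coherentCoeff z p.1 * coherentCoeff w p.2) 2 := by
  apply memℓp_gen
  have h := (summable_coherentCoeff_sq z).mul_of_nonneg (summable_coherentCoeff_sq w)
    (fun n => by positivity) (fun n => by positivity)
  refine h.congr fun p => ?_
  simp [mul_pow]

/-- The two-mode coherent state `|z, w⟩ = |z⟩ ⊗ |w⟩`. -/
def coherent (z w : ℂ) : Fock :=
  ⟨fun p => coherentCoeff z p.1 * coherentCoeff w p.2, memℓp_coherent z w⟩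

/-- The density operator `|ψ⟩⟨ψ|` of a pure state. -/
def pureState (ψ : Fock) : Fock →L[ℂ] Fock := InnerProductSpace.rankOne ℂ ψ ψ

/-- The Husimi function `H(αa, αb) = ⟨αa, αb | ρ | αa, αb⟩` of a density operator `ρ`. -/
def husimi (ρ : Fock →L[ℂ] Fock) (αa αb : ℂ) : ℝ :=
  (inner ℂ (coherent αa αb) (ρ (coherent αa αb))).re

/-! ## Entropies of functions on the phase space

Here `d²α` is Lebesgue measure `d(Re α) d(Im α)` on `ℂ`. -/

/-- `H^A(αa) = ∫ H(αa, αb) d²αb / π`. -/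
def marginalA (H : ℂ → ℂ → ℝ) (αa : ℂ) : ℝ := ∫ αb : ℂ, H αa αb / Real.pi

/-- `H^B(αb) = ∫ H(αa, αb) d²αa / π`. -/
def marginalB (H : ℂ → ℂ → ℝ) (αb : ℂ) : ℝ := ∫ αa : ℂ, H αa αb / Real.pi

/-- Joint entropy `-∫ H ln H d²αa d²αb / π²`. -/
def jointEntropy (H : ℂ → ℂ → ℝ) : ℝ :=
  -∫ p : ℂ × ℂ, H p.1 p.2 * Real.log (H p.1 p.2) / Real.pi ^ 2

/-- One-mode entropy `-∫ h ln h d²α / π`. -/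
def modeEntropy (h : ℂ → ℝ) : ℝ := -∫ α : ℂ, h α * Real.log (h α) / Real.pi

/-- The integrals that define the marginals, the joint entropy and the two partial entropies of
`H` all converge absolutely. -/
structure EntropiesConverge (H : ℂ → ℂ → ℝ) : Prop where
  marginalA : ∀ αa, MeasureTheory.Integrable fun αb => H αa αb
  marginalB : ∀ αb, MeasureTheory.Integrable fun αa => H αa αb
  joint : MeasureTheory.Integrable fun p : ℂ × ℂ => H p.1 p.2 * Real.log (H p.1 p.2)
  partA : MeasureTheory.Integrable fun α =>
    ParametricAmplifier.marginalA H α * Real.log (ParametricAmplifier.marginalA H α)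
  partB : MeasureTheory.Integrable fun α =>
    ParametricAmplifier.marginalB H α * Real.log (ParametricAmplifier.marginalB H α)

/-- The correlation functional `C[H] = 2 (1 - E[H] / (E[H^A] + E[H^B]))`. -/
def correlation (H : ℂ → ℂ → ℝ) : ℝ :=
  2 * (1 - jointEntropy H / (modeEntropy (marginalA H) + modeEntropy (marginalB H)))

/-- `L(t) = ln [1 + (|κ|/φ)² sinh² (φ t)]`. The square root `φ` of `|κ|² - (δ/2)²` may be purely
imaginary, so the expression is written over `ℂ`. -/
def logGain (κ φ : ℂ) (t : ℝ) : ℂ :=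
  Complex.log (1 + ((‖κ‖ : ℂ) / φ) ^ 2 * Complex.sinh (φ * t) ^ 2)

end ParametricAmplifier

end

/-!
The evolved state is known in closed form. A two-mode Gaussian state
`N exp (τ a†b† + u a† + v b†) |0, 0⟩` with `‖τ‖ < 1` stays Gaussian under a Hamiltonian quadratic in
the ladder operators, and the Schrödinger equation reduces to a Riccati equation for `τ`, linear
equations for `u` and `v`, and an equation for `log N`. With `C = cosh (φ t)`, `S = sinh (φ t) / φ`
(both real) and the gain `G = C - i (δ / 2) S`, all of them are solved by elementary functions, and
`|G|² = 1 + |κ|² S² = 1 / (1 - |τ|²)`; see `hasDerivAt_squeeze`, `hasDerivAt_displacement`,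
`hasDerivAt_prefactor` and `isEvolution_evolved`. Membership in Fock space and norm continuity hold
because the coefficients are absolutely summable, locally uniformly in the parameters
(`exists_summable_bound_gaussianCoeff`).

The equation is only tested against number states, so uniqueness is a statement about an infinite
system of ordinary differential equations. The Hamiltonian couples `(m, n)` only to
`(m ± 1, n ± 1)`, with strength growing linearly along each diagonal, and Carleman's criterion excludes a nonzero
bounded solution with zero initial value (`jacobi_eq_zero`).

The overlap of a Gaussian state with a coherent state is the value of its generating function, so
the Husimi function is a Gaussian. Completing the square factors it into a Gaussian of parameter
`Γ = |G|⁻²` in one variable and a Gaussian of parameter `1` in the other, up to translations and a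
shear (`husimi_gaussian_factor`). The marginals are then Gaussians of parameter `Γ`, whose entropy
is `1 - log Γ`, and the joint entropy is `(1 - log Γ) + 1`, where `-log Γ = log |G|²` is the
logarithmic gain.
-/

/-! ### Uniqueness of the evolution -/

namespace ParametricAmplifier

open Filter Topology Finset

/-- Carleman's criterion for a time-dependent Jacobi system: if the off-diagonal entries grow at
most linearly, then the only solution with uniformly bounded `ℓ²` norm and zero initial data is `0`.
The mass `∑_{j ≤ N} |d j|²` changes only by the flux through the link `N ↔ N + 1`; dividing by the
size of that link and summing over `N` bounds the weighted sum of these masses, whose weights form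
a divergent series. -/
theorem jacobi_eq_zero {a β : ℕ → ℝ} {e : ℝ → ℂ} {d : ℕ → ℝ → ℂ} {C K B T : ℝ}
    (hβ0 : β 0 = 0) (hβ : ∀ j, |β (j + 1)| ≤ j + 1 + K) (hK : 0 ≤ K) (he : ∀ t, ‖e t‖ ≤ C)
    (hd : ∀ j t, HasDerivAt (d j) (-Complex.I * (a j * d j t + e t * β (j + 1) * d (j + 1) t
      + starRingEnd ℂ (e t) * β j * d (j - 1) t)) t)
    (hB : ∀ t ∈ Set.uIcc 0 T, ∀ M, ∑ j ∈ range M, ‖d j t‖ ^ 2 ≤ B)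
    (h0 : ∀ j, d j 0 = 0) (j : ℕ) : d j T = 0 := by
  have hC : 0 ≤ C := (norm_nonneg _).trans (he 0)
  set F : ℕ → ℝ → ℝ := fun j t =>
    2 * (-Complex.I * e t * β (j + 1) * starRingEnd ℂ (d j t) * d (j + 1) t).re with hF
  -- the mass of the first `N + 1` sites changes by the flux `F N`
  have hmass : ∀ N t, HasDerivAt (fun s => ∑ j ∈ range (N + 1), ‖d j s‖ ^ 2) (F N t) t := by
    intro N
    have hsite : ∀ j t, HasDerivAt (fun s => ‖d j s‖ ^ 2)
        (F j t - 2 * (-Complex.I * e t * β j * starRingEnd ℂ (d (j - 1) t) * d j t).re) t := by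
      intro j t
      convert! (hd j t).norm_sq using 1
      simp only [hF, Complex.inner, Complex.mul_re, Complex.mul_im, Complex.add_re, Complex.add_im,
        Complex.neg_re, Complex.neg_im, Complex.I_re, Complex.I_im, Complex.conj_re,
        Complex.conj_im, Complex.ofReal_re, Complex.ofReal_im]
      ring
    induction N with
    | zero =>
      intro t
      simpa [hβ0] using hsite 0 t
    | succ N ih =>
      intro t
      simp_rw [sum_range_succ _ (N + 1)]
      convert! (ih t).add (hsite (N + 1) t) using 1
      simp [hF]
  have hflux : ∀ N t, |F N t / (N + 1 + K)| ≤ C * (‖d N t‖ ^ 2 + ‖d (N + 1) t‖ ^ 2) := by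
    intro N t
    have hpos : (0 : ℝ) < N + 1 + K := by positivity
    rw [abs_div, abs_of_pos hpos, div_le_iff₀ hpos]
    have h1 : |F N t| ≤ 2 * (‖e t‖ * |β (N + 1)| * ‖d N t‖ * ‖d (N + 1) t‖) := by
      rw [hF, abs_mul, abs_of_pos (two_pos : (0 : ℝ) < 2)]
      gcongr
      refine (Complex.abs_re_le_norm _).trans_eq ?_
      simp
    have h2 : ‖e t‖ * |β (N + 1)| ≤ C * (N + 1 + K) :=
      mul_le_mul (he t) (hβ N) (abs_nonneg _) hC
    have h3 : 2 * (‖d N t‖ * ‖d (N + 1) t‖) ≤ ‖d N t‖ ^ 2 + ‖d (N + 1) t‖ ^ 2 := by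
      nlinarith [sq_nonneg (‖d N t‖ - ‖d (N + 1) t‖)]
    calc |F N t| ≤ (‖e t‖ * |β (N + 1)|) * (2 * (‖d N t‖ * ‖d (N + 1) t‖)) := by
          linarith
      _ ≤ (C * (N + 1 + K)) * (‖d N t‖ ^ 2 + ‖d (N + 1) t‖ ^ 2) := by gcongr
      _ = _ := by ring
  set W : ℕ → ℝ → ℝ := fun M t =>
    ∑ N ∈ range M, (∑ j ∈ range (N + 1), ‖d j t‖ ^ 2) / (N + 1 + K) with hW
  have hWd : ∀ M t, HasDerivAt (W M) (∑ N ∈ range M, F N t / (N + 1 + K)) t := fun M t =>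
    HasDerivAt.fun_sum fun N _ => (hmass N t).div_const _
  have hWd' : ∀ M, ∀ t ∈ Set.uIcc 0 T, ‖∑ N ∈ range M, F N t / (N + 1 + K)‖ ≤ C * (B + B) := by
    intro M t ht
    calc _ ≤ ∑ N ∈ range M, C * (‖d N t‖ ^ 2 + ‖d (N + 1) t‖ ^ 2) :=
          (norm_sum_le _ _).trans (sum_le_sum fun N _ => hflux N t)
      _ = C * (∑ N ∈ range M, ‖d N t‖ ^ 2 + ∑ N ∈ range M, ‖d (N + 1) t‖ ^ 2) := by
          rw [← mul_sum, sum_add_distrib]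
      _ ≤ C * (B + B) := by
          gcongr
          · exact hB t ht M
          · refine le_trans ?_ (hB t ht (M + 1))
            rw [sum_range_succ']
            exact le_add_of_nonneg_right (by positivity)
  have hWT : ∀ M, W M T ≤ C * (B + B) * |T| := by
    intro M
    have h := (convex_uIcc (0 : ℝ) T).norm_image_sub_le_of_norm_hasDerivWithin_le
      (fun t _ => (hWd M t).hasDerivWithinAt) (hWd' M) Set.left_mem_uIcc Set.right_mem_uIcc
    have hz : W M 0 = 0 := by simp [hW, h0]
    rw [hz, sub_zero, sub_zero, Real.norm_eq_abs, Real.norm_eq_abs] at h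
    exact (le_abs_self _).trans h
  by_contra hne
  have hpos : 0 < ‖d j T‖ ^ 2 := by positivity
  -- from the `j`-th mass on, each term of `W` is at least `|d j|² / (N + 1 + K)`
  have hsum : Summable fun N : ℕ => ‖d j T‖ ^ 2 / ((N + j : ℕ) + 1 + K) := by
    refine summable_of_sum_range_le (c := C * (B + B) * |T|) (fun n => by positivity) fun M => ?_
    refine le_trans ?_ (hWT (M + j))
    calc _ ≤ ∑ N ∈ range M, (∑ i ∈ range (N + j + 1), ‖d i T‖ ^ 2) / ((N + j : ℕ) + 1 + K) := by
          refine sum_le_sum fun N _ => ?_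
          gcongr
          exact single_le_sum (f := fun i => ‖d i T‖ ^ 2) (fun i _ => by positivity)
            (mem_range.2 (by omega))
      _ ≤ W (M + j) T := by
          rw [hW, add_comm M j]
          beta_reduce
          rw [sum_range_add]
          simp only [add_comm j]
          exact le_add_of_nonneg_left (sum_nonneg fun i _ => by positivity)
  have hsum' : Summable fun N : ℕ => ((N : ℝ) + (j + 1 + K))⁻¹ := by
    refine (hsum.mul_left (‖d j T‖ ^ 2)⁻¹).congr fun N => ?_
    rw [div_eq_mul_inv, ← mul_assoc, inv_mul_cancel₀ hpos.ne', one_mul]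
    push_cast
    ring_nf
  obtain ⟨m, hm⟩ := exists_nat_ge (j + 1 + K)
  refine Real.not_summable_natCast_inv ((summable_nat_add_iff (m + 1)).1 ?_)
  refine (Summable.of_nonneg_of_le (fun N => by positivity) (fun N => ?_) hsum')
  refine inv_anti₀ (by positivity) ?_
  push_cast
  linarith

theorem hamiltonian_apply (ωa ωb δ : ℝ) (κ : ℂ) (t : ℝ) (c : ℕ × ℕ → ℂ) (p : ℕ × ℕ) :
    hamiltonian ωa ωb δ κ t c p = (ωa * p.1 + ωb * p.2) * c p
      + κ * Complex.exp (Complex.I * ((ωa + ωb + δ : ℝ) : ℂ) * t) *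
        ((Real.sqrt (p.1 + 1) * Real.sqrt (p.2 + 1) : ℝ) : ℂ) * c (p.1 + 1, p.2 + 1)
      + starRingEnd ℂ κ * Complex.exp (-(Complex.I * ((ωa + ωb + δ : ℝ) : ℂ) * t)) *
        ((Real.sqrt p.1 * Real.sqrt p.2 : ℝ) : ℂ) * c (p.1 - 1, p.2 - 1) := by
  obtain ⟨m, n⟩ := p
  have key : ∀ k : ℕ, (Real.sqrt k : ℂ) * (Real.sqrt ((k - 1 : ℕ) + 1) : ℂ) = k := by
    intro k
    cases k with
    | zero => simp
    | succ k =>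
      rw [Nat.add_sub_cancel, ← Complex.ofReal_mul, Nat.cast_succ,
        Real.mul_self_sqrt (by positivity)]
      push_cast
      rfl
  have hA : (opAdag * opA) c (m, n) = m * c (m, n) := by
    rcases m with _ | m
    · simp [opAdag, opA]
    · have := key (m + 1)
      simp only [Nat.add_sub_cancel] at this
      simp only [opAdag, opA, Module.End.mul_apply, LinearMap.coe_mk, AddHom.coe_mk,
        Nat.add_sub_cancel, ← mul_assoc]
      rw [this]
  have hB : (opBdag * opB) c (m, n) = n * c (m, n) := by
    rcases n with _ | n
    · simp [opBdag, opB]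
    · have := key (n + 1)
      simp only [Nat.add_sub_cancel] at this
      simp only [opBdag, opB, Module.End.mul_apply, LinearMap.coe_mk, AddHom.coe_mk,
        Nat.add_sub_cancel, ← mul_assoc]
      rw [this]
  simp only [hamiltonian, LinearMap.add_apply, LinearMap.smul_apply, Pi.add_apply, Pi.smul_apply,
    hA, hB, smul_eq_mul]
  simp only [opA, opB, opAdag, opBdag, Module.End.mul_apply, LinearMap.coe_mk, AddHom.coe_mk]
  push_cast
  ring

/-- The Hamiltonian couples `(m, n)` only to `(m ± 1, n ± 1)`, so along each diagonal of `ℕ × ℕ`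
the difference of two solutions obeys a Jacobi system to which Carleman's criterion applies. -/
theorem IsEvolution.unique {ωa ωb δ : ℝ} {κ : ℂ} {ψ₀ : Fock} {ψ χ : ℝ → Fock}
    (hψ : IsEvolution ωa ωb δ κ ψ₀ ψ) (hχ : IsEvolution ωa ωb δ κ ψ₀ χ) : ψ = χ := by
  funext T
  rw [← sub_eq_zero]
  refine lp.ext (funext fun p => ?_)
  obtain ⟨B, hB⟩ := (isCompact_uIcc (a := (0 : ℝ)) (b := T)).exists_bound_of_continuousOn
    (hψ.continuous.sub hχ.continuous).continuousOn
  set k := p.1 - min p.1 p.2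
  set l := p.2 - min p.1 p.2
  have hp : p = (k + min p.1 p.2, l + min p.1 p.2) := by ext <;> simp [k, l]
  have hkl : (k : ℕ) = 0 ∨ l = 0 := by omega
  rw [hp]
  have key := jacobi_eq_zero (a := fun j => ωa * (k + j : ℕ) + ωb * (l + j : ℕ))
    (β := fun j => Real.sqrt ((k + j : ℕ) : ℝ) * Real.sqrt ((l + j : ℕ) : ℝ))
    (e := fun t => κ * Complex.exp (Complex.I * ((ωa + ωb + δ : ℝ) : ℂ) * t))
    (d := fun j t => (ψ t - χ t : Fock) (k + j, l + j)) (C := ‖κ‖) (K := k + l) (B := B ^ 2)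
    (T := T) ?_ ?_ (by positivity) ?_ ?_ ?_ ?_ (min p.1 p.2)
  · exact key
  · rcases hkl with h | h <;> simp [h]
  · intro j
    rw [abs_of_nonneg (by positivity)]
    have h1 : Real.sqrt ((k + (j + 1) : ℕ) : ℝ) ≤ Real.sqrt (j + 1 + (k + l)) :=
      Real.sqrt_le_sqrt (by push_cast; nlinarith [(Nat.cast_nonneg l : (0 : ℝ) ≤ l)])
    have h2 : Real.sqrt ((l + (j + 1) : ℕ) : ℝ) ≤ Real.sqrt (j + 1 + (k + l)) :=
      Real.sqrt_le_sqrt (by push_cast; nlinarith [(Nat.cast_nonneg k : (0 : ℝ) ≤ k)])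
    refine (mul_le_mul h1 h2 (Real.sqrt_nonneg _) (Real.sqrt_nonneg _)).trans_eq ?_
    exact Real.mul_self_sqrt (by positivity)
  · intro t
    rw [norm_mul, mul_comm Complex.I, mul_right_comm, ← Complex.ofReal_mul,
      Complex.norm_exp_ofReal_mul_I, mul_one]
  · intro j t
    have h := (hψ.schrodinger t (k + j, l + j)).sub (hχ.schrodinger t (k + j, l + j))
    convert! h using 1
    rw [hamiltonian_apply, hamiltonian_apply]
    simp only [map_mul, ← Complex.exp_conj, Complex.conj_I, Complex.conj_ofReal, neg_mul,
      lp.coeFn_sub, Pi.sub_apply]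
    rcases j with _ | j
    · have h0 : Real.sqrt (k : ℝ) * Real.sqrt (l : ℝ) = 0 := by
        rcases hkl with h | h <;> simp [h]
      simp only [add_zero, h0]
      push_cast
      ring
    · simp only [← add_assoc, Nat.add_sub_cancel]
      push_cast
      ring
  · intro t ht M
    refine le_trans ?_ (pow_le_pow_left₀ (norm_nonneg _) (hB t ht) 2)
    have h := lp.sum_rpow_le_norm_rpow (p := 2) (by norm_num) (ψ t - χ t : Fock)
      ((range M).map ⟨fun j => (k + j, l + j), fun i j h => by simpa using congrArg Prod.fst h⟩)
    simp only [ENNReal.toReal_ofNat, Real.rpow_ofNat, sum_map] at h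
    exact h
  · intro j
    simp [hψ.initial, hχ.initial]

end ParametricAmplifier

/-! ### Taylor coefficients of `exp (τ x y + u x + v y)` -/

namespace ParametricAmplifier

open Filter Topology Finset

/-- The divided power `zʲ / j!`. The index is an integer, with value `0` at negative `j`, so that
the derivation rule and the index shifts below hold without boundary cases. -/
noncomputable def divPow (z : ℂ) (j : ℤ) : ℂ :=
  if 0 ≤ j then z ^ j.toNat / (j.toNat.factorial : ℂ) else 0

theorem divPow_natCast (z : ℂ) (j : ℕ) : divPow z j = z ^ j / (j.factorial : ℂ) := by
  simp [divPow]

theorem divPow_of_neg {j : ℤ} (hj : j < 0) (z : ℂ) : divPow z j = 0 := by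
  simp [divPow, hj.not_ge]

theorem mul_divPow (z : ℂ) (j : ℤ) : j * divPow z j = z * divPow z (j - 1) := by
  rcases lt_trichotomy j 0 with h | rfl | h
  · rw [divPow_of_neg h, divPow_of_neg (by omega), mul_zero, mul_zero]
  · rw [divPow_of_neg (by omega : (0 : ℤ) - 1 < 0)]
    simp
  · obtain ⟨n, rfl⟩ : ∃ n : ℕ, j = (n + 1 : ℕ) := ⟨j.toNat - 1, by omega⟩
    rw [show ((n + 1 : ℕ) : ℤ) - 1 = n by push_cast; ring, divPow_natCast, divPow_natCast,
      Nat.factorial_succ]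
    have h1 : (n.factorial : ℂ) ≠ 0 := by exact_mod_cast n.factorial_ne_zero
    have h2 : (n + 1 : ℂ) ≠ 0 := by exact_mod_cast n.succ_ne_zero
    push_cast
    field_simp
    ring

theorem hasDerivAt_divPow (z : ℂ) (j : ℤ) :
    HasDerivAt (fun w => divPow w j) (divPow z (j - 1)) z := by
  rcases lt_trichotomy j 0 with h | rfl | h
  · simp only [divPow_of_neg h, divPow_of_neg (show j - 1 < 0 by omega)]
    exact hasDerivAt_const _ _
  · rw [divPow_of_neg (by omega : (0 : ℤ) - 1 < 0)]
    simpa [divPow] using hasDerivAt_const z (1 : ℂ)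
  · obtain ⟨n, rfl⟩ : ∃ n : ℕ, j = (n + 1 : ℕ) := ⟨j.toNat - 1, by omega⟩
    rw [show ((n + 1 : ℕ) : ℤ) - 1 = n by push_cast; ring, divPow_natCast]
    simp only [divPow_natCast]
    convert! (hasDerivAt_pow (n + 1) z).div_const ((n + 1).factorial : ℂ) using 1
    have h1 : (n.factorial : ℂ) ≠ 0 := by exact_mod_cast n.factorial_ne_zero
    have h2 : (n + 1 : ℂ) ≠ 0 := by exact_mod_cast n.succ_ne_zero
    rw [Nat.factorial_succ]
    push_cast
    field_simp

/-- The coefficient of `xᵐ yⁿ` in `exp (τ x y + u x + v y)`. -/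
noncomputable def expTaylor (τ u v : ℂ) (m n : ℤ) : ℂ :=
  ∑ k ∈ range (m.toNat + 1), divPow τ k * divPow u (m - k) * divPow v (n - k)

variable (τ u v : ℂ)

theorem expTaylor_eq_sum {m n : ℤ} {K : ℕ} (hK : m < K) :
    expTaylor τ u v m n = ∑ k ∈ range K, divPow τ k * divPow u (m - k) * divPow v (n - k) := by
  have key : ∀ K' : ℕ, m < K' → ∀ r : ℕ,
      ∑ k ∈ range (K' + r), divPow τ k * divPow u (m - k) * divPow v (n - k)
        = ∑ k ∈ range K', divPow τ k * divPow u (m - k) * divPow v (n - k) := by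
    intro K' hK' r
    rw [sum_range_add, add_eq_left]
    refine sum_eq_zero fun k _ => ?_
    rw [divPow_of_neg (j := m - (K' + k : ℕ)) (by push_cast; omega)]
    ring
  rw [expTaylor, ← key (m.toNat + 1) (by push_cast; omega) K, add_comm, key K hK]

theorem sum_divPow_shift {m n : ℤ} {K : ℕ} (hK : m < K) :
    ∑ k ∈ range (K + 1), divPow τ (k - 1) * divPow u (m - k) * divPow v (n - k)
      = expTaylor τ u v (m - 1) (n - 1) := by
  rw [expTaylor_eq_sum τ u v (K := K) (by omega), sum_range_succ']
  rw [divPow_of_neg (j := ((0 : ℕ) : ℤ) - 1) (by simp)]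
  simp only [zero_mul, add_zero]
  refine sum_congr rfl fun k _ => ?_
  rw [show ((k + 1 : ℕ) : ℤ) - 1 = k by push_cast; ring,
    show m - ((k + 1 : ℕ) : ℤ) = m - 1 - k by push_cast; ring,
    show n - ((k + 1 : ℕ) : ℤ) = n - 1 - k by push_cast; ring]

/-- Coefficient form of `x ∂ₓ f = (τ x y + u x) f`. -/
theorem fst_mul_expTaylor (m n : ℤ) :
    m * expTaylor τ u v m n = τ * expTaylor τ u v (m - 1) (n - 1)
      + u * expTaylor τ u v (m - 1) n := by
  rw [← sum_divPow_shift τ u v (K := m.toNat + 1) (by push_cast; omega),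
    expTaylor_eq_sum τ u v (m := m) (K := m.toNat + 2) (by push_cast; omega),
    expTaylor_eq_sum τ u v (m := m - 1) (K := m.toNat + 2) (by push_cast; omega),
    mul_sum, mul_sum, mul_sum, ← sum_add_distrib]
  refine sum_congr rfl fun k _ => ?_
  have h1 := mul_divPow τ k
  have h2 := mul_divPow u (m - k)
  rw [show m - 1 - (k : ℤ) = m - k - 1 by ring]
  push_cast at h1 h2
  linear_combination (divPow u (m - k) * divPow v (n - k)) * h1
    + (divPow τ k * divPow v (n - k)) * h2

/-- Coefficient form of `y ∂ᵧ f = (τ x y + v y) f`. -/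
theorem snd_mul_expTaylor (m n : ℤ) :
    n * expTaylor τ u v m n = τ * expTaylor τ u v (m - 1) (n - 1)
      + v * expTaylor τ u v m (n - 1) := by
  rw [← sum_divPow_shift τ u v (K := m.toNat + 1) (by push_cast; omega),
    expTaylor_eq_sum τ u v (m := m) (n := n) (K := m.toNat + 2) (by push_cast; omega),
    expTaylor_eq_sum τ u v (m := m) (n := n - 1) (K := m.toNat + 2) (by push_cast; omega),
    mul_sum, mul_sum, mul_sum, ← sum_add_distrib]
  refine sum_congr rfl fun k _ => ?_
  have h1 := mul_divPow τ k
  have h2 := mul_divPow v (n - k)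
  rw [show n - 1 - (k : ℤ) = n - k - 1 by ring]
  push_cast at h1 h2
  linear_combination (divPow u (m - k) * divPow v (n - k)) * h1
    + (divPow τ k * divPow u (m - k)) * h2

theorem expTaylor_of_neg_left {m : ℤ} (hm : m < 0) (n : ℤ) : expTaylor τ u v m n = 0 := by
  rw [expTaylor_eq_sum τ u v (K := 0) (by simpa using hm), range_zero, sum_empty]

theorem expTaylor_of_neg_right (m : ℤ) {n : ℤ} (hn : n < 0) : expTaylor τ u v m n = 0 :=
  sum_eq_zero fun k _ => by rw [divPow_of_neg (j := n - k) (by omega), mul_zero]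

theorem expTaylor_zero_left (m n : ℤ) : expTaylor 0 u v m n = divPow u m * divPow v n := by
  rw [expTaylor, sum_eq_single 0]
  · simp [divPow]
  · intro k _ hk
    rw [divPow_natCast, zero_pow hk]
    simp
  · simp

theorem hasDerivAt_expTaylor {τ u v : ℝ → ℂ} {τ' u' v' : ℂ} {t : ℝ} (hτ : HasDerivAt τ τ' t)
    (hu : HasDerivAt u u' t) (hv : HasDerivAt v v' t) (m n : ℤ) :
    HasDerivAt (fun s => expTaylor (τ s) (u s) (v s) m n)
      (τ' * expTaylor (τ t) (u t) (v t) (m - 1) (n - 1)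
        + u' * expTaylor (τ t) (u t) (v t) (m - 1) n
        + v' * expTaylor (τ t) (u t) (v t) m (n - 1)) t := by
  have hc : ∀ {w : ℝ → ℂ} {w' : ℂ}, HasDerivAt w w' t → ∀ j : ℤ,
      HasDerivAt (fun s => divPow (w s) j) (divPow (w t) (j - 1) * w') t := fun hw j =>
    (hasDerivAt_divPow _ j).comp t hw
  have h := HasDerivAt.fun_sum (u := range (m.toNat + 2)) fun k _ =>
    ((hc hτ (k : ℤ)).mul (hc hu (m - k))).mul (hc hv (n - k))
  simp only [Pi.mul_apply] at h
  convert! h using 1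
  · funext s
    exact expTaylor_eq_sum _ _ _ (by push_cast; omega)
  · rw [← sum_divPow_shift _ _ _ (K := m.toNat + 1) (by push_cast; omega),
      expTaylor_eq_sum _ _ _ (m := m - 1) (n := n) (K := m.toNat + 2) (by push_cast; omega),
      expTaylor_eq_sum _ _ _ (m := m) (n := n - 1) (K := m.toNat + 2) (by push_cast; omega),
      mul_sum, mul_sum, mul_sum, ← sum_add_distrib, ← sum_add_distrib]
    refine sum_congr rfl fun k _ => ?_
    rw [show m - 1 - (k : ℤ) = m - k - 1 by ring, show n - 1 - (k : ℤ) = n - k - 1 by ring]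
    ring

/-! ### Two-mode Gaussian states -/

/-- The coefficient of `|k + i, k + j⟩` contributed by the `(k, i, j)` term of
`exp (τ a†b†) exp (u a†) exp (v b†) |0, 0⟩`. -/
noncomputable def gaussianCoeff (τ u v : ℂ) (x : ℕ × ℕ × ℕ) : ℂ :=
  ((Real.sqrt (x.1 + x.2.1).factorial * Real.sqrt (x.1 + x.2.2).factorial : ℝ) : ℂ) *
    ((τ ^ x.1 / x.1.factorial) * ((u ^ x.2.1 / x.2.1.factorial) * (v ^ x.2.2 / x.2.2.factorial)))

/-- The unnormalized two-mode Gaussian state `exp (τ a†b† + u a† + v b†) |0, 0⟩`. The series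
converges for `‖τ‖ < 1`. -/
noncomputable def gaussian (τ u v : ℂ) : Fock :=
  ∑' x : ℕ × ℕ × ℕ, lp.single 2 (x.1 + x.2.1, x.1 + x.2.2) (gaussianCoeff τ u v x)

/-- The estimate `C(k + i, k) ≤ (1 + y)ᵏ ((1 + y) / y)ⁱ`, with `1 + y = w ^ 2`: the exponential
rate in `k` can be made as close to `1` as desired. -/
theorem exists_sqrt_factorial_add_le {w : ℝ} (hw : 1 < w) : ∃ R : ℝ, 0 ≤ R ∧ ∀ k i : ℕ,
    Real.sqrt (k + i).factorial
      ≤ w ^ k * R ^ i * (Real.sqrt k.factorial * Real.sqrt i.factorial) := by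
  have hy : 0 < w ^ 2 - 1 := by nlinarith
  refine ⟨w / Real.sqrt (w ^ 2 - 1), by positivity, fun k i => ?_⟩
  rw [← Real.sqrt_mul (by positivity), Real.sqrt_le_left (by positivity)]
  have hbin : ((k + i).choose k : ℝ) * (w ^ 2 - 1) ^ i ≤ (w ^ 2) ^ (k + i) := by
    have h := add_pow (1 : ℝ) (w ^ 2 - 1) (k + i)
    rw [add_sub_cancel] at h
    rw [h]
    refine le_trans (le_of_eq ?_) (single_le_sum (f := fun m => (1 : ℝ) ^ m *
      (w ^ 2 - 1) ^ (k + i - m) * ((k + i).choose m : ℝ)) (fun m _ => by positivity)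
      (mem_range.2 (by omega : k < k + i + 1)))
    simp only [one_pow, one_mul, Nat.add_sub_cancel_left]
    ring
  have hfac : ((k + i).factorial : ℝ) = (k + i).choose k * (k.factorial * i.factorial) := by
    have h := Nat.add_choose_mul_factorial_mul_factorial k i
    rw [mul_assoc, ← Nat.choose_symm_add] at h
    exact_mod_cast h.symm
  rw [hfac, mul_pow, Real.sq_sqrt (by positivity)]
  refine mul_le_mul_of_nonneg_right ?_ (by positivity)
  have : (w ^ k * (w / Real.sqrt (w ^ 2 - 1)) ^ i) ^ 2 = (w ^ 2) ^ (k + i) / (w ^ 2 - 1) ^ i := by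
    rw [div_pow, mul_pow, div_pow, ← pow_mul (Real.sqrt _), mul_comm i 2, pow_mul,
      Real.sq_sqrt hy.le]
    ring
  rw [this, le_div_iff₀ (by positivity)]
  exact hbin

theorem summable_pow_div_sqrt_factorial (x : ℝ) :
    Summable fun n : ℕ => x ^ n / Real.sqrt n.factorial := by
  -- `|x|ⁿ / √n! = 2⁻ⁿ · (2 |x|)ⁿ / √n!`, and the product is at most the sum of the squares
  refine Summable.of_norm_bounded ((summable_geometric_of_lt_one (r := (1 / 4 : ℝ)) (by norm_num)
    (by norm_num)).add (Real.summable_pow_div_factorial (4 * x ^ 2))) fun n => ?_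
  have hf : 0 < Real.sqrt n.factorial := Real.sqrt_pos.2 (by exact_mod_cast n.factorial_pos)
  have h2 : (4 * x ^ 2) ^ n / (n.factorial : ℝ) = ((2 * |x|) ^ n / Real.sqrt n.factorial) ^ 2 := by
    rw [div_pow, Real.sq_sqrt (by positivity), ← pow_mul, mul_comm n 2, pow_mul, mul_pow 2, sq_abs]
    norm_num
  have h1 : (1 / 4 : ℝ) ^ n = ((1 / 2) ^ n) ^ 2 := by
    rw [← pow_mul, mul_comm n 2, pow_mul]; norm_num
  have h3 : ‖x ^ n / Real.sqrt n.factorial‖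
      = (1 / 2) ^ n * ((2 * |x|) ^ n / Real.sqrt n.factorial) := by
    rw [norm_div, norm_pow, Real.norm_eq_abs, Real.norm_eq_abs, abs_of_pos hf, mul_div_assoc',
      ← mul_pow]
    congr 2
    ring
  rw [h1, h2, h3]
  nlinarith [sq_nonneg ((1 / 2 : ℝ) ^ n - (2 * |x|) ^ n / Real.sqrt n.factorial),
    sq_nonneg ((1 / 2 : ℝ) ^ n), sq_nonneg ((2 * |x|) ^ n / Real.sqrt n.factorial)]

theorem norm_gaussianCoeff (x : ℕ × ℕ × ℕ) : ‖gaussianCoeff τ u v x‖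
    = Real.sqrt (x.1 + x.2.1).factorial * Real.sqrt (x.1 + x.2.2).factorial *
      ((‖τ‖ ^ x.1 / x.1.factorial) *
        ((‖u‖ ^ x.2.1 / x.2.1.factorial) * (‖v‖ ^ x.2.2 / x.2.2.factorial))) := by
  simp only [gaussianCoeff, norm_mul, norm_div, norm_pow, Complex.norm_natCast, Complex.norm_real,
    Real.norm_eq_abs, abs_of_nonneg (Real.sqrt_nonneg _)]

/-- The coefficients of a Gaussian state with `‖τ‖ < 1` are even absolutely summable, uniformly for
parameters in bounded sets. -/
theorem exists_summable_bound_gaussianCoeff {r : ℝ} (hr0 : 0 < r) (hr : r < 1) (U V : ℝ) :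
    ∃ b : ℕ × ℕ × ℕ → ℝ, Summable b ∧ ∀ τ u v : ℂ, ‖τ‖ ≤ r → ‖u‖ ≤ U → ‖v‖ ≤ V →
      ∀ x, ‖gaussianCoeff τ u v x‖ ≤ b x := by
  obtain ⟨w, hw1, hw⟩ : ∃ w : ℝ, 1 < w ∧ r * (w * w) < 1 := by
    have h1 : 1 < Real.sqrt (1 / r) := by
      rw [Real.lt_sqrt zero_le_one, one_pow, lt_div_iff₀ hr0]; linarith
    obtain ⟨w, hw1, hw2⟩ := exists_between h1
    refine ⟨w, hw1, ?_⟩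
    have h2 : w * w < 1 / r := by
      rw [← Real.mul_self_sqrt (show 0 ≤ 1 / r by positivity)]
      exact mul_self_lt_mul_self (by linarith) hw2
    calc r * (w * w) < r * (1 / r) := by gcongr
      _ = 1 := by field_simp
  obtain ⟨R, hR0, hR⟩ := exists_sqrt_factorial_add_le hw1
  refine ⟨fun x => (r * (w * w)) ^ x.1 * (((R * U) ^ x.2.1 / Real.sqrt x.2.1.factorial) *
    ((R * V) ^ x.2.2 / Real.sqrt x.2.2.factorial)), ?_, ?_⟩
  · have hgeo := summable_geometric_of_lt_one (by positivity) hw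
    have hUV := summable_mul_of_summable_norm (summable_pow_div_sqrt_factorial (R * U)).norm
      (summable_pow_div_sqrt_factorial (R * V)).norm
    exact summable_mul_of_summable_norm hgeo.norm hUV.norm
  · rintro τ u v hτ hu hv ⟨k, i, j⟩
    rw [norm_gaussianCoeff]
    have hU : 0 ≤ U := (norm_nonneg _).trans hu
    have hV : 0 ≤ V := (norm_nonneg _).trans hv
    have hs : ∀ n : ℕ, ∃ a : ℝ, a ≠ 0 ∧ Real.sqrt n.factorial = a ∧ (n.factorial : ℝ) = a * a :=
      fun n => ⟨_, (Real.sqrt_pos.2 (by exact_mod_cast n.factorial_pos)).ne', rfl,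
        (Real.mul_self_sqrt (by positivity)).symm⟩
    obtain ⟨a, ha0, ha, ha'⟩ := hs k
    obtain ⟨b, hb0, hb, hb'⟩ := hs i
    obtain ⟨c, hc0, hc, hc'⟩ := hs j
    calc _ ≤ (w ^ k * R ^ i * (Real.sqrt k.factorial * Real.sqrt i.factorial)) *
          (w ^ k * R ^ j * (Real.sqrt k.factorial * Real.sqrt j.factorial)) *
          ((r ^ k / k.factorial) * ((U ^ i / i.factorial) * (V ^ j / j.factorial))) := by
          gcongr
          · exact hR k i
          · exact hR k j
      _ = _ := by
          dsimp only
          rw [ha, hb, hc, ha', hb', hc']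
          rw [mul_pow, mul_pow, mul_pow, mul_pow]
          field_simp

variable {τ}

theorem summable_norm_gaussianCoeff (hτ : ‖τ‖ < 1) :
    Summable fun x => ‖gaussianCoeff τ u v x‖ := by
  obtain ⟨r, hr1, hr2⟩ := exists_between hτ
  obtain ⟨b, hb, h⟩ := exists_summable_bound_gaussianCoeff ((norm_nonneg _).trans_lt hr1) hr2
    ‖u‖ ‖v‖
  exact Summable.of_nonneg_of_le (fun _ => norm_nonneg _) (h τ u v hr1.le le_rfl le_rfl) hb

theorem summable_gaussian (hτ : ‖τ‖ < 1) : Summable fun x : ℕ × ℕ × ℕ =>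
    (lp.single 2 (x.1 + x.2.1, x.1 + x.2.2) (gaussianCoeff τ u v x) : Fock) := by
  refine Summable.of_norm ?_
  simp only [lp.norm_single (p := 2) (by norm_num)]
  exact summable_norm_gaussianCoeff u v hτ

theorem gaussian_apply (hτ : ‖τ‖ < 1) (m n : ℕ) : gaussian τ u v (m, n)
    = ((Real.sqrt m.factorial * Real.sqrt n.factorial : ℝ) : ℂ) * expTaylor τ u v m n := by
  have h := (lp.evalCLM ℂ (fun _ : ℕ × ℕ => ℂ) 2 (m, n)).map_tsum (summable_gaussian u v hτ)
  refine h.trans (HasSum.tsum_eq ?_)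
  set f : ℕ × ℕ × ℕ → ℂ := fun x => (lp.evalCLM ℂ (fun _ : ℕ × ℕ => ℂ) 2 (m, n))
    (lp.single 2 (x.1 + x.2.1, x.1 + x.2.2) (gaussianCoeff τ u v x)) with hf
  have hfx : ∀ k i j, f (k, i, j)
      = if (m, n) = (k + i, k + j) then gaussianCoeff τ u v (k, i, j) else 0 := by
    intro k i j
    exact (lp.single_apply 2 _ _ _).trans (Pi.single_apply _ _ _)
  have hinj : Set.InjOn (fun k => (k, m - k, n - k)) (range (m + 1) : Set ℕ) :=
    fun a _ b _ hab => congrArg Prod.fst hab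
  have hsum : ∑ x ∈ (range (m + 1)).image (fun k => (k, m - k, n - k)), f x
      = ((Real.sqrt m.factorial * Real.sqrt n.factorial : ℝ) : ℂ) * expTaylor τ u v m n := by
    rw [sum_image hinj, expTaylor, Int.toNat_natCast, mul_sum]
    refine sum_congr rfl fun k hk => ?_
    have hkm : k ≤ m := by simpa [Nat.lt_succ_iff] using hk
    rw [hfx]
    by_cases hkn : k ≤ n
    · rw [if_pos (by simp [hkm, hkn]), gaussianCoeff,
        ← Nat.cast_sub hkm, ← Nat.cast_sub hkn, divPow_natCast, divPow_natCast, divPow_natCast]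
      simp only [Nat.add_sub_cancel' hkm, Nat.add_sub_cancel' hkn]
      ring
    · rw [if_neg (fun h => by have := congrArg Prod.snd h; simp at this; omega),
        divPow_of_neg (j := (n : ℤ) - k) (by omega)]
      ring
  rw [← hsum]
  refine hasSum_sum_of_ne_finset_zero ?_
  rintro ⟨k, i, j⟩ hx
  rw [hfx, if_neg]
  rintro h
  obtain ⟨rfl, rfl⟩ := Prod.mk.inj h
  exact hx (mem_image.2 ⟨k, by simp, by simp⟩)

theorem continuousOn_gaussian : ContinuousOn (fun x : ℂ × ℂ × ℂ => gaussian x.1 x.2.1 x.2.2)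
    {x | ‖x.1‖ < 1} := by
  rintro ⟨τ, u, v⟩ (hτ : ‖τ‖ < 1)
  obtain ⟨r, hr1, hr2⟩ := exists_between hτ
  obtain ⟨b, hb, hle⟩ := exists_summable_bound_gaussianCoeff ((norm_nonneg _).trans_lt hr1) hr2
    (‖u‖ + 1) (‖v‖ + 1)
  set s : Set (ℂ × ℂ × ℂ) := {x | ‖x.1‖ < r ∧ ‖x.2.1‖ < ‖u‖ + 1 ∧ ‖x.2.2‖ < ‖v‖ + 1}
  have hs : IsOpen s := by
    exact (isOpen_lt continuous_fst.norm continuous_const).inter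
      ((isOpen_lt continuous_snd.fst.norm continuous_const).inter
        (isOpen_lt continuous_snd.snd.norm continuous_const))
  refine ContinuousAt.continuousWithinAt (ContinuousOn.continuousAt (s := s) ?_
    (hs.mem_nhds ⟨hr1, by simp, by simp⟩))
  refine continuousOn_tsum (fun x => ?_) hb fun x y hy => ?_
  · refine Continuous.continuousOn ?_
    refine (lp.isometry_single (p := 2) (E := fun _ : ℕ × ℕ => ℂ) _).continuous.comp ?_
    unfold gaussianCoeff
    fun_prop
  · rw [lp.norm_single (p := 2) (by norm_num)]
    exact hle _ _ _ hy.1.le hy.2.1.le hy.2.2.le x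

theorem conj_coherentCoeff_mul_sqrt (z : ℂ) (n : ℕ) :
    starRingEnd ℂ (coherentCoeff z n) * (Real.sqrt n.factorial : ℂ)
      = (Real.exp (-‖z‖ ^ 2 / 2) : ℂ) * (starRingEnd ℂ z) ^ n := by
  have h : (Real.sqrt (n.factorial : ℝ) : ℂ) ≠ 0 := by
    exact_mod_cast (Real.sqrt_pos.2 (by exact_mod_cast n.factorial_pos)).ne'
  simp only [coherentCoeff, map_div₀, map_mul, map_pow, Complex.conj_ofReal]
  field_simp

/-- The overlap of one term of the series of a Gaussian state with a coherent state is a term of a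
product of three exponential series. -/
theorem inner_coherent_single_gaussianCoeff (z w τ u v : ℂ) (k i j : ℕ) :
    inner ℂ (coherent z w) (lp.single 2 (k + i, k + j) (gaussianCoeff τ u v (k, i, j)) : Fock)
      = ((Real.exp (-‖z‖ ^ 2 / 2) * Real.exp (-‖w‖ ^ 2 / 2) : ℝ) : ℂ) *
        ((τ * (starRingEnd ℂ z * starRingEnd ℂ w)) ^ k / k.factorial *
          ((u * starRingEnd ℂ z) ^ i / i.factorial *
            ((v * starRingEnd ℂ w) ^ j / j.factorial))) := by
  rw [lp.inner_single_right, RCLike.inner_apply]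
  change gaussianCoeff τ u v (k, i, j) * starRingEnd ℂ
    (coherentCoeff z (k + i) * coherentCoeff w (k + j)) = _
  have hz := conj_coherentCoeff_mul_sqrt z (k + i)
  have hw := conj_coherentCoeff_mul_sqrt w (k + j)
  rw [map_mul, gaussianCoeff, Complex.ofReal_mul, Complex.ofReal_mul]
  generalize (Real.exp (-‖z‖ ^ 2 / 2) : ℂ) = A at *
  generalize (Real.exp (-‖w‖ ^ 2 / 2) : ℂ) = B at *
  generalize starRingEnd ℂ (coherentCoeff z (k + i)) = cz at *
  generalize starRingEnd ℂ (coherentCoeff w (k + j)) = cw at *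
  generalize (Real.sqrt (k + i).factorial : ℂ) = sz at *
  generalize (Real.sqrt (k + j).factorial : ℂ) = sw at *
  calc _ = (cz * sz) * (cw * sw) * (τ ^ k / k.factorial * (u ^ i / i.factorial *
        (v ^ j / j.factorial))) := by ring
    _ = _ := by rw [hz, hw]; ring

theorem hasSum_mul_prod {ι ι' : Type*} {f : ι → ℂ} {g : ι' → ℂ} {a b : ℂ} (hf : HasSum f a)
    (hg : HasSum g b) : HasSum (fun x : ι × ι' => f x.1 * g x.2) (a * b) :=
  hf.mul hg (summable_mul_of_summable_norm hf.summable.norm hg.summable.norm)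

theorem hasSum_pow_div_factorial_exp (x : ℂ) :
    HasSum (fun n : ℕ => x ^ n / (n.factorial : ℂ)) (Complex.exp x) := by
  rw [Complex.exp_eq_exp_ℂ]
  exact NormedSpace.expSeries_div_hasSum_exp x

/-- Overlaps with coherent states are the values of the generating function. -/
theorem inner_coherent_gaussian (hτ : ‖τ‖ < 1) (z w : ℂ) :
    inner ℂ (coherent z w) (gaussian τ u v)
      = ((Real.exp (-‖z‖ ^ 2 / 2) * Real.exp (-‖w‖ ^ 2 / 2) : ℝ) : ℂ) *
        Complex.exp (τ * (starRingEnd ℂ z * starRingEnd ℂ w) + u * starRingEnd ℂ z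
          + v * starRingEnd ℂ w) := by
  have h := (summable_gaussian u v hτ).hasSum.mapL (innerSL ℂ (coherent z w))
  have hexp := hasSum_mul_prod
    (hasSum_pow_div_factorial_exp (τ * (starRingEnd ℂ z * starRingEnd ℂ w)))
    (hasSum_mul_prod (hasSum_pow_div_factorial_exp (u * starRingEnd ℂ z))
      (hasSum_pow_div_factorial_exp (v * starRingEnd ℂ w)))
  rw [add_assoc, Complex.exp_add, Complex.exp_add]
  refine h.unique ((hexp.mul_left _).congr_fun ?_)
  rintro ⟨k, i, j⟩
  exact inner_coherent_single_gaussianCoeff z w τ u v k i j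

end ParametricAmplifier

/-! ### Solution of the classical equations of motion -/

namespace ParametricAmplifier

open Filter Topology Finset

/-- `cosh (φ t)`, which is real when `φ ^ 2` is. -/
noncomputable def ampCosh (φ : ℂ) (t : ℝ) : ℝ := (Complex.cosh (φ * t)).re

/-- `sinh (φ t) / φ`, which is real when `φ ^ 2` is. -/
noncomputable def ampSinh (φ : ℂ) (t : ℝ) : ℝ := (Complex.sinh (φ * t) / φ).re

theorem conj_eq_or_eq_neg_of_sq_eq_ofReal {φ : ℂ} {r : ℝ} (hφ : φ ^ 2 = (r : ℂ)) :
    starRingEnd ℂ φ = φ ∨ starRingEnd ℂ φ = -φ := by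
  rw [← sq_eq_sq_iff_eq_or_eq_neg, ← map_pow, hφ, Complex.conj_ofReal]

theorem ofReal_ampCosh {φ : ℂ} {r : ℝ} (hφ : φ ^ 2 = (r : ℂ)) (t : ℝ) :
    (ampCosh φ t : ℂ) = Complex.cosh (φ * t) := by
  refine Complex.conj_eq_iff_re.1 ?_
  rw [← Complex.cosh_conj, map_mul, Complex.conj_ofReal]
  rcases conj_eq_or_eq_neg_of_sq_eq_ofReal hφ with h | h <;> simp [h]

theorem ofReal_ampSinh {φ : ℂ} {r : ℝ} (hφ : φ ^ 2 = (r : ℂ)) (t : ℝ) :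
    (ampSinh φ t : ℂ) = Complex.sinh (φ * t) / φ := by
  refine Complex.conj_eq_iff_re.1 ?_
  rw [map_div₀, ← Complex.sinh_conj, map_mul, Complex.conj_ofReal]
  rcases conj_eq_or_eq_neg_of_sq_eq_ofReal hφ with h | h <;> simp [h]

theorem ampCosh_sq_sub {φ : ℂ} {r : ℝ} (hφ : φ ^ 2 = (r : ℂ)) (hφ0 : φ ≠ 0) (t : ℝ) :
    ampCosh φ t ^ 2 - r * ampSinh φ t ^ 2 = 1 := by
  have h := Complex.cosh_sq_sub_sinh_sq (φ * t)
  have : ((ampCosh φ t ^ 2 - r * ampSinh φ t ^ 2 : ℝ) : ℂ) = 1 := by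
    push_cast
    rw [ofReal_ampCosh hφ, ofReal_ampSinh hφ, ← hφ, ← h]
    field_simp
  exact_mod_cast this

theorem hasDerivAt_ampCosh {φ : ℂ} {r : ℝ} (hφ : φ ^ 2 = (r : ℂ)) (hφ0 : φ ≠ 0) (t : ℝ) :
    HasDerivAt (fun s => (ampCosh φ s : ℂ)) (r * ampSinh φ t) t := by
  simp only [ofReal_ampCosh hφ, ofReal_ampSinh hφ]
  have h := ((Complex.hasDerivAt_cosh (φ * t)).comp (t : ℂ)
    ((hasDerivAt_id (t : ℂ)).const_mul φ)).comp_ofReal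
  convert! h using 1
  rw [← hφ]
  field_simp

theorem hasDerivAt_ampSinh {φ : ℂ} {r : ℝ} (hφ : φ ^ 2 = (r : ℂ)) (hφ0 : φ ≠ 0) (t : ℝ) :
    HasDerivAt (fun s => (ampSinh φ s : ℂ)) (ampCosh φ t) t := by
  simp only [ofReal_ampCosh hφ, ofReal_ampSinh hφ]
  have h := (((Complex.hasDerivAt_sinh (φ * t)).comp (t : ℂ)
    ((hasDerivAt_id (t : ℂ)).const_mul φ)).div_const φ).comp_ofReal
  convert! h using 1
  field_simp

/-- The complex gain `G(t) = cosh (φ t) - i (δ / 2) sinh (φ t) / φ`. -/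
noncomputable def gain (δ : ℝ) (φ : ℂ) (t : ℝ) : ℂ :=
  ampCosh φ t - Complex.I * (δ / 2 : ℝ) * ampSinh φ t

/-- Squeezing parameter `τ(t)` of the evolved state. -/
noncomputable def squeeze (ωa ωb δ : ℝ) (κ φ : ℂ) (t : ℝ) : ℂ :=
  Complex.exp (-(Complex.I * ((ωa + ωb + δ : ℝ) : ℂ) * t)) *
    (-Complex.I * starRingEnd ℂ κ * ampSinh φ t / gain δ φ t)

/-- Linear parameter of one mode of the evolved state: `ω` is the frequency of the mode and `ζ` its
initial amplitude. -/
noncomputable def displacement (ω δ : ℝ) (φ ζ : ℂ) (t : ℝ) : ℂ :=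
  ζ * Complex.exp (-(Complex.I * ((ω + δ / 2 : ℝ) : ℂ) * t)) / gain δ φ t

/-- Scalar prefactor of the evolved state. -/
noncomputable def prefactor (δ : ℝ) (κ φ ζa ζb : ℂ) (t : ℝ) : ℂ :=
  ((Real.exp (-‖ζa‖ ^ 2 / 2) * Real.exp (-‖ζb‖ ^ 2 / 2) : ℝ) : ℂ) *
    (Complex.exp (-(Complex.I * ((δ / 2 : ℝ) : ℂ) * t)) / gain δ φ t *
      Complex.exp (-Complex.I * κ * ζa * ζb * ampSinh φ t / gain δ φ t))

section

variable {ωa ωb δ : ℝ} {κ φ : ℂ} (t : ℝ)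

theorem norm_gain_sq (hφ : φ ^ 2 = ((‖κ‖ ^ 2 - (δ / 2) ^ 2 : ℝ) : ℂ)) (hφ0 : φ ≠ 0) (t : ℝ) :
    ‖gain δ φ t‖ ^ 2 = 1 + ‖κ‖ ^ 2 * ampSinh φ t ^ 2 := by
  have h := ampCosh_sq_sub hφ hφ0 t
  rw [← Complex.normSq_eq_norm_sq, Complex.normSq_apply, gain]
  simp
  linear_combination h

theorem gain_ne_zero (hφ : φ ^ 2 = ((‖κ‖ ^ 2 - (δ / 2) ^ 2 : ℝ) : ℂ)) (hφ0 : φ ≠ 0) (t : ℝ) :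
    gain δ φ t ≠ 0 := by
  intro h
  have := norm_gain_sq hφ hφ0 t
  rw [h, norm_zero] at this
  nlinarith [mul_nonneg (sq_nonneg ‖κ‖) (sq_nonneg (ampSinh φ t))]

theorem hasDerivAt_gain (hφ : φ ^ 2 = ((‖κ‖ ^ 2 - (δ / 2) ^ 2 : ℝ) : ℂ)) (hφ0 : φ ≠ 0) (t : ℝ) :
    HasDerivAt (gain δ φ) (((‖κ‖ ^ 2 - (δ / 2) ^ 2 : ℝ) : ℂ) * ampSinh φ t
      - Complex.I * (δ / 2 : ℝ) * ampCosh φ t) t :=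
  (hasDerivAt_ampCosh hφ hφ0 t).sub ((hasDerivAt_ampSinh hφ hφ0 t).const_mul _)

theorem hasDerivAt_exp_neg_I_mul (ω t : ℝ) :
    HasDerivAt (fun s : ℝ => Complex.exp (-(Complex.I * (ω : ℂ) * s)))
      (Complex.exp (-(Complex.I * (ω : ℂ) * t)) * -(Complex.I * ω)) t := by
  have h := ((Complex.hasDerivAt_exp (-(Complex.I * (ω : ℂ) * t))).comp (t : ℂ)
    (((hasDerivAt_id (t : ℂ)).const_mul (Complex.I * (ω : ℂ))).neg)).comp_ofReal
  convert! h using 1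
  simp

theorem hasDerivAt_ampSinh_div_gain (hφ : φ ^ 2 = ((‖κ‖ ^ 2 - (δ / 2) ^ 2 : ℝ) : ℂ))
    (hφ0 : φ ≠ 0) (t : ℝ) :
    HasDerivAt (fun s => (ampSinh φ s : ℂ) / gain δ φ s) (1 / gain δ φ t ^ 2) t := by
  convert! (hasDerivAt_ampSinh hφ hφ0 t).div (hasDerivAt_gain hφ hφ0 t) (gain_ne_zero hφ hφ0 t)
    using 1
  have h : ((ampCosh φ t ^ 2 - (‖κ‖ ^ 2 - (δ / 2) ^ 2) * ampSinh φ t ^ 2 : ℝ) : ℂ) = 1 := by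
    rw [ampCosh_sq_sub hφ hφ0 t, Complex.ofReal_one]
  congr 1
  rw [gain]
  push_cast at h ⊢
  linear_combination -h

theorem exp_mul_squeeze : Complex.exp (Complex.I * ((ωa + ωb + δ : ℝ) : ℂ) * t) *
    squeeze ωa ωb δ κ φ t = -Complex.I * starRingEnd ℂ κ * ampSinh φ t / gain δ φ t := by
  rw [squeeze, ← mul_assoc, ← Complex.exp_add, add_neg_cancel, Complex.exp_zero, one_mul]

/-- The Riccati equation for the squeezing parameter. -/
theorem hasDerivAt_squeeze (hφ : φ ^ 2 = ((‖κ‖ ^ 2 - (δ / 2) ^ 2 : ℝ) : ℂ)) (hφ0 : φ ≠ 0)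
    (t : ℝ) : HasDerivAt (squeeze ωa ωb δ κ φ)
      (-Complex.I * ((ωa + ωb) * squeeze ωa ωb δ κ φ t
        + κ * Complex.exp (Complex.I * ((ωa + ωb + δ : ℝ) : ℂ) * t) * squeeze ωa ωb δ κ φ t ^ 2
        + starRingEnd ℂ κ * Complex.exp (-(Complex.I * ((ωa + ωb + δ : ℝ) : ℂ) * t)))) t := by
  have h := (hasDerivAt_exp_neg_I_mul (ωa + ωb + δ) t).mul
    ((hasDerivAt_ampSinh_div_gain hφ hφ0 t).const_mul (-Complex.I * starRingEnd ℂ κ))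
  convert! h using 1
  · funext s
    simp only [squeeze, Pi.mul_apply]
    ring
  · rw [sq (squeeze _ _ _ _ _ _), ← mul_assoc, mul_assoc κ, exp_mul_squeeze, squeeze]
    generalize Complex.exp _ = E
    have hG := gain_ne_zero hφ hφ0 t
    have hC : ((ampCosh φ t ^ 2 - (‖κ‖ ^ 2 - (δ / 2) ^ 2) * ampSinh φ t ^ 2 : ℝ) : ℂ) = 1 := by
      rw [ampCosh_sq_sub hφ hφ0 t, Complex.ofReal_one]
    have hκ := Complex.mul_conj' κ
    have hG' : gain δ φ t = ampCosh φ t - Complex.I * (δ / 2 : ℝ) * ampSinh φ t := rfl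
    field_simp
    rw [hG']
    push_cast at hC ⊢
    generalize (ampCosh φ t : ℂ) = c at *
    generalize (ampSinh φ t : ℂ) = s at *
    generalize starRingEnd ℂ κ = κ' at *
    linear_combination (E * κ') * (s ^ 2 * hκ - hC
      + ((δ / 2) ^ 2 - κ * κ') * s ^ 2 * Complex.I_sq)

theorem hasDerivAt_displacement (hφ : φ ^ 2 = ((‖κ‖ ^ 2 - (δ / 2) ^ 2 : ℝ) : ℂ)) (hφ0 : φ ≠ 0)
    (ω : ℝ) (ζ : ℂ) (t : ℝ) : HasDerivAt (displacement ω δ φ ζ)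
      (-Complex.I * (ω + κ * (-Complex.I * starRingEnd ℂ κ * ampSinh φ t / gain δ φ t)) *
        displacement ω δ φ ζ t) t := by
  have hG := gain_ne_zero hφ hφ0 t
  convert! ((hasDerivAt_exp_neg_I_mul (ω + δ / 2) t).const_mul ζ).div (hasDerivAt_gain hφ hφ0 t) hG
    using 1
  rw [displacement]
  generalize Complex.exp _ = E
  have hκ := Complex.mul_conj' κ
  have hG' : gain δ φ t = ampCosh φ t - Complex.I * (δ / 2 : ℝ) * ampSinh φ t := rfl
  field_simp
  rw [hG']
  push_cast
  linear_combination (ζ * E * ampSinh φ t) *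
    ((κ * starRingEnd ℂ κ - (δ / 2) ^ 2) * Complex.I_sq - hκ)

theorem exp_mul_displacement_mul (ζa ζb : ℂ) :
    Complex.exp (Complex.I * ((ωa + ωb + δ : ℝ) : ℂ) * t) *
      (displacement ωa δ φ ζa t * displacement ωb δ φ ζb t) = ζa * ζb / gain δ φ t ^ 2 := by
  have h : Complex.exp (Complex.I * ((ωa + ωb + δ : ℝ) : ℂ) * t) *
      (Complex.exp (-(Complex.I * ((ωa + δ / 2 : ℝ) : ℂ) * t)) *
        Complex.exp (-(Complex.I * ((ωb + δ / 2 : ℝ) : ℂ) * t))) = 1 := by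
    rw [← Complex.exp_add, ← Complex.exp_add, ← Complex.exp_zero]
    congr 1
    push_cast
    ring
  simp only [displacement]
  linear_combination (ζa * ζb / gain δ φ t ^ 2) * h

theorem hasDerivAt_prefactor (hφ : φ ^ 2 = ((‖κ‖ ^ 2 - (δ / 2) ^ 2 : ℝ) : ℂ)) (hφ0 : φ ≠ 0)
    (ζa ζb : ℂ) (t : ℝ) : HasDerivAt (prefactor δ κ φ ζa ζb)
      (-Complex.I * κ * (-Complex.I * starRingEnd ℂ κ * ampSinh φ t / gain δ φ t
        + ζa * ζb / gain δ φ t ^ 2) * prefactor δ κ φ ζa ζb t) t := by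
  have hG := gain_ne_zero hφ hφ0 t
  have h1 := (hasDerivAt_exp_neg_I_mul (δ / 2) t).div (hasDerivAt_gain hφ hφ0 t) hG
  have h2 := ((hasDerivAt_ampSinh_div_gain hφ hφ0 t).const_mul (-Complex.I * κ * ζa * ζb)).cexp
  convert! (h1.mul h2).const_mul
    ((Real.exp (-‖ζa‖ ^ 2 / 2) * Real.exp (-‖ζb‖ ^ 2 / 2) : ℝ) : ℂ) using 1
  · funext s
    simp only [prefactor, Pi.mul_apply, Pi.div_apply, mul_div_assoc]
  · simp only [prefactor, Pi.div_apply, mul_div_assoc]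
    generalize ((Real.exp (-‖ζa‖ ^ 2 / 2) * Real.exp (-‖ζb‖ ^ 2 / 2) : ℝ) : ℂ) = A
    generalize Complex.exp _ = E
    generalize Complex.exp _ = E'
    have hκ := Complex.mul_conj' κ
    have hG' : gain δ φ t = ampCosh φ t - Complex.I * (δ / 2 : ℝ) * ampSinh φ t := rfl
    field_simp
    rw [hG']
    push_cast
    linear_combination
      (A * E * E' * ampSinh φ t * (ampCosh φ t - Complex.I * (δ / 2) * ampSinh φ t)) *
        ((κ * starRingEnd ℂ κ - (δ / 2) ^ 2) * Complex.I_sq - hκ)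

end

end ParametricAmplifier

/-! ### Existence of the evolution -/

namespace ParametricAmplifier

open Filter Topology Finset

theorem norm_exp_neg_I_mul (ω t : ℝ) : ‖Complex.exp (-(Complex.I * (ω : ℂ) * t))‖ = 1 := by
  rw [mul_assoc, ← Complex.ofReal_mul, mul_comm, ← neg_mul, ← Complex.ofReal_neg,
    Complex.norm_exp_ofReal_mul_I]

theorem norm_squeeze_sq {ωa ωb δ : ℝ} {κ φ : ℂ}
    (hφ : φ ^ 2 = ((‖κ‖ ^ 2 - (δ / 2) ^ 2 : ℝ) : ℂ)) (hφ0 : φ ≠ 0) (t : ℝ) :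
    ‖squeeze ωa ωb δ κ φ t‖ ^ 2 = 1 - (‖gain δ φ t‖ ^ 2)⁻¹ := by
  have hG : ‖gain δ φ t‖ ^ 2 ≠ 0 := pow_ne_zero 2 (norm_ne_zero_iff.2 (gain_ne_zero hφ hφ0 t))
  rw [squeeze, norm_mul, norm_exp_neg_I_mul, one_mul, norm_div, norm_mul, norm_mul, norm_neg,
    Complex.norm_I, one_mul, RCLike.norm_conj, Complex.norm_real, div_pow, mul_pow, Real.norm_eq_abs, sq_abs]
  rw [eq_sub_iff_add_eq, inv_eq_one_div, ← add_div, div_eq_one_iff_eq hG, norm_gain_sq hφ hφ0 t]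
  ring

theorem norm_squeeze_lt_one {ωa ωb δ : ℝ} {κ φ : ℂ}
    (hφ : φ ^ 2 = ((‖κ‖ ^ 2 - (δ / 2) ^ 2 : ℝ) : ℂ)) (hφ0 : φ ≠ 0) (t : ℝ) :
    ‖squeeze ωa ωb δ κ φ t‖ < 1 := by
  have hG : 0 < ‖gain δ φ t‖ := norm_pos_iff.2 (gain_ne_zero hφ hφ0 t)
  have h := norm_squeeze_sq (ωa := ωa) (ωb := ωb) hφ hφ0 t
  have : 0 < (‖gain δ φ t‖ ^ 2)⁻¹ := by positivity
  exact (sq_lt_one_iff₀ (norm_nonneg _)).1 (by linarith)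

/-- The state at time `t` that evolves from the coherent state `|ζa, ζb⟩`. -/
noncomputable def evolved (ωa ωb δ : ℝ) (κ φ ζa ζb : ℂ) (t : ℝ) : Fock :=
  prefactor δ κ φ ζa ζb t •
    gaussian (squeeze ωa ωb δ κ φ t) (displacement ωa δ φ ζa t) (displacement ωb δ φ ζb t)

/-- The coefficient form of the action of `a b` on `exp (τ a†b† + u a† + v b†) |0, 0⟩`. -/
theorem succ_mul_succ_mul_expTaylor (τ u v : ℂ) (m n : ℤ) :
    (m + 1) * (n + 1) * expTaylor τ u v (m + 1) (n + 1)
      = (τ + u * v) * expTaylor τ u v m n + τ ^ 2 * expTaylor τ u v (m - 1) (n - 1)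
        + τ * u * expTaylor τ u v (m - 1) n + τ * v * expTaylor τ u v m (n - 1) := by
  have h1 := fst_mul_expTaylor τ u v (m + 1) (n + 1)
  have h2 := snd_mul_expTaylor τ u v m (n + 1)
  have h3 := snd_mul_expTaylor τ u v m n
  simp only [add_sub_cancel_right] at h1 h2
  push_cast at h1 h2
  linear_combination (n + 1 : ℂ) * h1 + u * h2 + τ * h3

theorem sqrt_succ_mul_sqrt_factorial_succ (n : ℕ) :
    Real.sqrt (n + 1) * Real.sqrt (n + 1).factorial = (n + 1) * Real.sqrt n.factorial := by
  rw [Nat.factorial_succ, Nat.cast_mul, Real.sqrt_mul (by positivity), Nat.cast_succ, ← mul_assoc,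
    Real.mul_self_sqrt (by positivity)]

theorem evolved_apply {ωa ωb δ : ℝ} {κ φ : ℂ}
    (hφ : φ ^ 2 = ((‖κ‖ ^ 2 - (δ / 2) ^ 2 : ℝ) : ℂ)) (hφ0 : φ ≠ 0) (ζa ζb : ℂ) (t : ℝ) (m n : ℕ) :
    evolved ωa ωb δ κ φ ζa ζb t (m, n) = prefactor δ κ φ ζa ζb t *
      (((Real.sqrt m.factorial * Real.sqrt n.factorial : ℝ) : ℂ) *
        expTaylor (squeeze ωa ωb δ κ φ t) (displacement ωa δ φ ζa t) (displacement ωb δ φ ζb t)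
          m n) := by
  rw [← gaussian_apply _ _ (norm_squeeze_lt_one hφ hφ0 t)]
  rfl

theorem evolved_zero {ωa ωb δ : ℝ} {κ φ : ℂ}
    (hφ : φ ^ 2 = ((‖κ‖ ^ 2 - (δ / 2) ^ 2 : ℝ) : ℂ)) (hφ0 : φ ≠ 0) (ζa ζb : ℂ) :
    evolved ωa ωb δ κ φ ζa ζb 0 = coherent ζa ζb := by
  have hS : ampSinh φ 0 = 0 := by simp [ampSinh]
  have hC : ampCosh φ 0 = 1 := by simp [ampCosh]
  have hG : gain δ φ 0 = 1 := by simp [gain, hS, hC]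
  refine lp.ext (funext fun p => ?_)
  obtain ⟨m, n⟩ := p
  rw [evolved_apply hφ hφ0]
  have hsq : ∀ k : ℕ, (Real.sqrt k.factorial : ℂ) ≠ 0 ∧
      (k.factorial : ℂ) = (Real.sqrt k.factorial : ℂ) * (Real.sqrt k.factorial : ℂ) := fun k =>
    ⟨by exact_mod_cast (Real.sqrt_pos.2 (by exact_mod_cast k.factorial_pos)).ne', by
      rw [← Complex.ofReal_mul, Real.mul_self_sqrt (by positivity), Complex.ofReal_natCast]⟩
  obtain ⟨hm0, hm⟩ := hsq m
  obtain ⟨hn0, hn⟩ := hsq n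
  have hτ : squeeze ωa ωb δ κ φ 0 = 0 := by simp [squeeze, hS]
  have hu : ∀ ω ζ, displacement ω δ φ ζ 0 = ζ := by simp [displacement, hG]
  have hN : prefactor δ κ φ ζa ζb 0
      = ((Real.exp (-‖ζa‖ ^ 2 / 2) * Real.exp (-‖ζb‖ ^ 2 / 2) : ℝ) : ℂ) := by
    simp [prefactor, hS, hG]
  rw [hτ, hu, hu, hN, expTaylor_zero_left, divPow_natCast, divPow_natCast, hm, hn]
  change _ = coherentCoeff ζa m * coherentCoeff ζb n
  rw [coherentCoeff, coherentCoeff, Complex.ofReal_mul, Complex.ofReal_mul]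
  field_simp

theorem continuous_evolved {ωa ωb δ : ℝ} {κ φ : ℂ}
    (hφ : φ ^ 2 = ((‖κ‖ ^ 2 - (δ / 2) ^ 2 : ℝ) : ℂ)) (hφ0 : φ ≠ 0) (ζa ζb : ℂ) :
    Continuous (evolved ωa ωb δ κ φ ζa ζb) := by
  have hτ : Continuous (squeeze ωa ωb δ κ φ) :=
    continuous_iff_continuousAt.2 fun t => (hasDerivAt_squeeze hφ hφ0 t).continuousAt
  have hu : ∀ ω ζ, Continuous (displacement ω δ φ ζ) := fun ω ζ =>
    continuous_iff_continuousAt.2 fun t => (hasDerivAt_displacement hφ hφ0 ω ζ t).continuousAt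
  have hN : Continuous (prefactor δ κ φ ζa ζb) :=
    continuous_iff_continuousAt.2 fun t => (hasDerivAt_prefactor hφ hφ0 ζa ζb t).continuousAt
  have hg := continuousOn_gaussian.comp_continuous (hτ.prodMk ((hu ωa ζa).prodMk (hu ωb ζb)))
    fun t => norm_squeeze_lt_one hφ hφ0 t
  unfold evolved
  exact hN.smul hg

theorem isEvolution_evolved {ωa ωb δ : ℝ} {κ φ : ℂ}
    (hφ : φ ^ 2 = ((‖κ‖ ^ 2 - (δ / 2) ^ 2 : ℝ) : ℂ)) (hφ0 : φ ≠ 0) (ζa ζb : ℂ) :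
    IsEvolution ωa ωb δ κ (coherent ζa ζb) (evolved ωa ωb δ κ φ ζa ζb) := by
  have hτd := fun t => hasDerivAt_squeeze (ωa := ωa) (ωb := ωb) hφ hφ0 t
  have hud := fun t => hasDerivAt_displacement hφ hφ0 ωa ζa t
  have hvd := fun t => hasDerivAt_displacement hφ hφ0 ωb ζb t
  have hNd := fun t => hasDerivAt_prefactor hφ hφ0 ζa ζb t
  refine ⟨?_, evolved_zero hφ hφ0 ζa ζb, ?_⟩
  · exact continuous_evolved hφ hφ0 ζa ζb
  · rintro t ⟨m, n⟩
    have hg := hasDerivAt_expTaylor (hτd t) (hud t) (hvd t) m n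
    have h := (hNd t).mul (hg.const_mul
      ((Real.sqrt m.factorial * Real.sqrt n.factorial : ℝ) : ℂ))
    have hfun : (fun s : ℝ => (evolved ωa ωb δ κ φ ζa ζb s : ℕ × ℕ → ℂ) (m, n)) =
        fun s => prefactor δ κ φ ζa ζb s * (((Real.sqrt m.factorial * Real.sqrt n.factorial : ℝ) :
          ℂ) * expTaylor (squeeze ωa ωb δ κ φ s) (displacement ωa δ φ ζa s)
            (displacement ωb δ φ ζb s) m n) :=
      funext fun s => evolved_apply hφ hφ0 ζa ζb s m n
    rw [hfun]
    refine h.congr_deriv (Eq.symm ?_)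
    have hlow : ((Real.sqrt m * Real.sqrt n : ℝ) : ℂ) *
        evolved ωa ωb δ κ φ ζa ζb t (m - 1, n - 1) = prefactor δ κ φ ζa ζb t *
        (((Real.sqrt m.factorial * Real.sqrt n.factorial : ℝ) : ℂ) * expTaylor
          (squeeze ωa ωb δ κ φ t) (displacement ωa δ φ ζa t) (displacement ωb δ φ ζb t)
          (m - 1) (n - 1)) := by
      rcases m with _ | m
      · rw [expTaylor_of_neg_left _ _ _ (by simp)]
        simp
      rcases n with _ | n
      · rw [expTaylor_of_neg_right _ _ _ _ (by simp)]
        simp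
      rw [evolved_apply hφ hφ0, Nat.factorial_succ, Nat.factorial_succ, Nat.cast_mul, Nat.cast_mul,
        Real.sqrt_mul (by positivity), Real.sqrt_mul (by positivity)]
      simp only [Nat.add_sub_cancel]
      push_cast
      simp only [add_sub_cancel_right]
      ring
    have hhigh : ((Real.sqrt (m + 1) * Real.sqrt (n + 1) : ℝ) : ℂ) *
        evolved ωa ωb δ κ φ ζa ζb t (m + 1, n + 1) = prefactor δ κ φ ζa ζb t *
        (((Real.sqrt m.factorial * Real.sqrt n.factorial : ℝ) : ℂ) * ((m + 1) * (n + 1) * expTaylor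
          (squeeze ωa ωb δ κ φ t) (displacement ωa δ φ ζa t) (displacement ωb δ φ ζb t)
          (m + 1) (n + 1))) := by
      have h1 := congrArg (fun x : ℝ => (x : ℂ)) (sqrt_succ_mul_sqrt_factorial_succ m)
      have h2 := congrArg (fun x : ℝ => (x : ℂ)) (sqrt_succ_mul_sqrt_factorial_succ n)
      rw [evolved_apply hφ hφ0]
      push_cast at h1 h2 ⊢
      generalize (Real.sqrt (m + 1) : ℂ) = x1 at *
      generalize (Real.sqrt (n + 1) : ℂ) = x2 at *
      generalize (Real.sqrt (m + 1).factorial : ℂ) = y1 at *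
      generalize (Real.sqrt (n + 1).factorial : ℂ) = y2 at *
      generalize expTaylor _ _ _ _ _ = g
      generalize prefactor δ κ φ ζa ζb t = N
      linear_combination N * g * (x2 * y2 * h1 + (m + 1) * (Real.sqrt m.factorial : ℂ) * h2)
    rw [hamiltonian_apply, mul_assoc (κ * _), hhigh, mul_assoc (starRingEnd ℂ κ * _), hlow,
      evolved_apply hφ hφ0, ← exp_mul_squeeze (ωa := ωa) (ωb := ωb),
      ← exp_mul_displacement_mul (ωa := ωa) (ωb := ωb)]
    have f1 := fst_mul_expTaylor (squeeze ωa ωb δ κ φ t) (displacement ωa δ φ ζa t)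
      (displacement ωb δ φ ζb t) m n
    have f2 := snd_mul_expTaylor (squeeze ωa ωb δ κ φ t) (displacement ωa δ φ ζa t)
      (displacement ωb δ φ ζb t) m n
    have f3 := succ_mul_succ_mul_expTaylor (squeeze ωa ωb δ κ φ t) (displacement ωa δ φ ζa t)
      (displacement ωb δ φ ζb t) m n
    simp only [Int.cast_natCast] at f1 f2 f3
    rw [f3]
    generalize ((Real.sqrt m.factorial * Real.sqrt n.factorial : ℝ) : ℂ) = S
    generalize prefactor δ κ φ ζa ζb t = N
    generalize squeeze ωa ωb δ κ φ t = τ at *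
    generalize displacement ωa δ φ ζa t = u at *
    generalize displacement ωb δ φ ζb t = v at *
    dsimp only
    linear_combination (-Complex.I * N * S) * (ωa * f1 + ωb * f2)

/-! ### The Husimi function of the evolved state -/

theorem husimi_pureState (ψ : Fock) (z w : ℂ) :
    husimi (pureState ψ) z w = ‖inner ℂ (coherent z w) ψ‖ ^ 2 := by
  rw [husimi, pureState, InnerProductSpace.rankOne_apply, inner_smul_right,
    ← inner_conj_symm ψ, mul_comm, RCLike.mul_conj]
  norm_cast

theorem husimi_smul_gaussian (N : ℂ) {τ : ℂ} (hτ : ‖τ‖ < 1) (u v z w : ℂ) :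
    husimi (pureState (N • gaussian τ u v)) z w = ‖N‖ ^ 2 * Real.exp (-‖z‖ ^ 2 - ‖w‖ ^ 2
      + 2 * (τ * (starRingEnd ℂ z * starRingEnd ℂ w) + u * starRingEnd ℂ z
        + v * starRingEnd ℂ w).re) := by
  rw [husimi_pureState, inner_smul_right, inner_coherent_gaussian u v hτ, norm_mul, norm_mul,
    Complex.norm_exp, Complex.norm_real, Real.norm_eq_abs, abs_of_pos (by positivity),
    ← Real.exp_add, ← Real.exp_add, mul_pow, ← Real.exp_nat_mul]
  congr 2
  push_cast
  ring

/-- Normalization of the evolved state. -/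
theorem norm_prefactor_sq_mul_exp {ωa ωb δ : ℝ} {κ φ : ℂ}
    (hφ : φ ^ 2 = ((‖κ‖ ^ 2 - (δ / 2) ^ 2 : ℝ) : ℂ)) (hφ0 : φ ≠ 0) (ζa ζb : ℂ) (t : ℝ) :
    ‖prefactor δ κ φ ζa ζb t‖ ^ 2 * Real.exp ((‖displacement ωa δ φ ζa t‖ ^ 2
      + ‖displacement ωb δ φ ζb t‖ ^ 2 + 2 * (starRingEnd ℂ (squeeze ωa ωb δ κ φ t) *
        displacement ωa δ φ ζa t * displacement ωb δ φ ζb t).re) * ‖gain δ φ t‖ ^ 2)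
      = (‖gain δ φ t‖ ^ 2)⁻¹ := by
  have hG := gain_ne_zero hφ hφ0 t
  have hGn : ‖gain δ φ t‖ ≠ 0 := norm_ne_zero_iff.2 hG
  have hu : ∀ ω ζ, ‖displacement ω δ φ ζ t‖ ^ 2 * ‖gain δ φ t‖ ^ 2 = ‖ζ‖ ^ 2 := by
    intro ω ζ
    rw [displacement, norm_div, norm_mul, norm_exp_neg_I_mul]
    field_simp
  have hcross : starRingEnd ℂ (squeeze ωa ωb δ κ φ t) * displacement ωa δ φ ζa t *
      displacement ωb δ φ ζb t * ((‖gain δ φ t‖ ^ 2 : ℝ) : ℂ)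
      = Complex.I * κ * ζa * ζb * ampSinh φ t / gain δ φ t := by
    have h1 := exp_mul_displacement_mul (ωa := ωa) (ωb := ωb) (δ := δ) (φ := φ) t ζa ζb
    rw [squeeze]
    have h2 : starRingEnd ℂ (Complex.exp (-(Complex.I * ((ωa + ωb + δ : ℝ) : ℂ) * t)))
        = Complex.exp (Complex.I * ((ωa + ωb + δ : ℝ) : ℂ) * t) := by
      rw [← Complex.exp_conj]
      simp
    have hG' : starRingEnd ℂ (gain δ φ t) ≠ 0 := by simpa using hG
    rw [Complex.ofReal_pow, ← Complex.mul_conj', map_mul, h2, map_div₀, map_mul, map_mul,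
      map_neg, Complex.conj_I, Complex.conj_conj, Complex.conj_ofReal]
    field_simp at h1 ⊢
    linear_combination (κ * ampSinh φ t) * h1
  have hre := congrArg Complex.re hcross
  rw [Complex.re_mul_ofReal] at hre
  rw [add_mul, add_mul, hu, hu, mul_assoc, hre, prefactor, norm_mul, norm_mul, norm_div,
    norm_exp_neg_I_mul,
    Complex.norm_exp, Complex.norm_real, Real.norm_eq_abs, abs_of_pos (by positivity),
    ← Real.exp_add]
  have hneg : (-Complex.I * κ * ζa * ζb * ampSinh φ t / gain δ φ t).re
      = -(Complex.I * κ * ζa * ζb * ampSinh φ t / gain δ φ t).re := by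
    rw [← Complex.neg_re]
    congr 1
    ring
  rw [hneg]
  generalize (Complex.I * κ * ζa * ζb * ampSinh φ t / gain δ φ t).re = x
  rw [mul_pow, mul_pow, ← Real.exp_nat_mul, ← Real.exp_nat_mul, div_pow, one_pow, one_div,
    mul_assoc, mul_assoc, ← Real.exp_add, mul_left_comm, ← Real.exp_add]
  rw [mul_eq_left₀ (by positivity), Real.exp_eq_one_iff]
  push_cast
  ring

end ParametricAmplifier

/-! ### Entropies of Gaussian functions on the phase space -/

namespace ParametricAmplifier

open MeasureTheory

/-- The Gaussian function `Γ exp (-Γ |z - a|²)`, of total mass `1` for `d²z / π`. -/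
noncomputable def gaussDensity (Γ : ℝ) (a z : ℂ) : ℝ := Γ * Real.exp (-Γ * ‖z - a‖ ^ 2)

variable {Γ : ℝ}

theorem integral_exp_neg_mul_norm_sq (hΓ : 0 < Γ) :
    ∫ z : ℂ, Real.exp (-Γ * ‖z‖ ^ 2) = Real.pi / Γ := by
  have h := Complex.integral_exp_neg_mul_rpow (p := 2) one_le_two hΓ
  norm_num [Real.Gamma_two, Real.rpow_neg_one] at h
  simpa [div_eq_mul_inv] using h

theorem integral_norm_sq_mul_exp_neg_mul_norm_sq (hΓ : 0 < Γ) :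
    ∫ z : ℂ, ‖z‖ ^ 2 * Real.exp (-Γ * ‖z‖ ^ 2) = Real.pi / Γ ^ 2 := by
  have h := Complex.integral_rpow_mul_exp_neg_mul_rpow (p := 2) (q := 2) one_le_two
    (by norm_num) hΓ
  norm_num [Real.Gamma_two, Real.rpow_neg hΓ.le] at h
  simpa [div_eq_mul_inv] using h

theorem integrable_exp_neg_mul_norm_sq (hΓ : 0 < Γ) :
    Integrable fun z : ℂ => Real.exp (-Γ * ‖z‖ ^ 2) :=
  .of_integral_ne_zero (by rw [integral_exp_neg_mul_norm_sq hΓ]; positivity)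

theorem integrable_norm_sq_mul_exp_neg_mul_norm_sq (hΓ : 0 < Γ) :
    Integrable fun z : ℂ => ‖z‖ ^ 2 * Real.exp (-Γ * ‖z‖ ^ 2) :=
  .of_integral_ne_zero (by rw [integral_norm_sq_mul_exp_neg_mul_norm_sq hΓ]; positivity)

theorem log_gaussDensity (hΓ : 0 < Γ) (a z : ℂ) :
    Real.log (gaussDensity Γ a z) = Real.log Γ - Γ * ‖z - a‖ ^ 2 := by
  rw [gaussDensity, Real.log_mul hΓ.ne' (Real.exp_pos _).ne', Real.log_exp]
  ring

theorem integrable_gaussDensity (hΓ : 0 < Γ) (a : ℂ) : Integrable (gaussDensity Γ a) :=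
  ((integrable_exp_neg_mul_norm_sq hΓ).comp_sub_right a).const_mul Γ

theorem integral_gaussDensity (hΓ : 0 < Γ) (a : ℂ) : ∫ z, gaussDensity Γ a z = Real.pi := by
  simp only [gaussDensity]
  rw [integral_const_mul, integral_sub_right_eq_self (fun z : ℂ => Real.exp (-Γ * ‖z‖ ^ 2)),
    integral_exp_neg_mul_norm_sq hΓ]
  field_simp

theorem gaussDensity_mul_log (hΓ : 0 < Γ) (a z : ℂ) :
    gaussDensity Γ a z * Real.log (gaussDensity Γ a z) = Real.log Γ * gaussDensity Γ a z
      - Γ ^ 2 * (‖z - a‖ ^ 2 * Real.exp (-Γ * ‖z - a‖ ^ 2)) := by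
  rw [log_gaussDensity hΓ, gaussDensity]
  ring

theorem integrable_gaussDensity_mul_log (hΓ : 0 < Γ) (a : ℂ) :
    Integrable fun z => gaussDensity Γ a z * Real.log (gaussDensity Γ a z) := by
  simp only [gaussDensity_mul_log hΓ]
  exact ((integrable_gaussDensity hΓ a).const_mul _).sub
    (((integrable_norm_sq_mul_exp_neg_mul_norm_sq hΓ).comp_sub_right a).const_mul _)

theorem integral_gaussDensity_mul_log (hΓ : 0 < Γ) (a : ℂ) :
    ∫ z, gaussDensity Γ a z * Real.log (gaussDensity Γ a z) = Real.pi * (Real.log Γ - 1) := by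
  simp only [gaussDensity_mul_log hΓ]
  rw [integral_sub ((integrable_gaussDensity hΓ a).const_mul _)
    (((integrable_norm_sq_mul_exp_neg_mul_norm_sq hΓ).comp_sub_right a).const_mul _),
    integral_const_mul, integral_const_mul, integral_gaussDensity hΓ,
    integral_sub_right_eq_self (fun z : ℂ => ‖z‖ ^ 2 * Real.exp (-Γ * ‖z‖ ^ 2)),
    integral_norm_sq_mul_exp_neg_mul_norm_sq hΓ]
  field_simp

theorem modeEntropy_gaussDensity (hΓ : 0 < Γ) (a : ℂ) :
    modeEntropy (gaussDensity Γ a) = 1 - Real.log Γ := by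
  rw [modeEntropy, integral_div, integral_gaussDensity_mul_log hΓ]
  field_simp
  ring

/-- A Gaussian function of two modes, factored into a Gaussian in `z` and a Gaussian in `w` of width
`1` whose centre depends on `z`. The shear `(z, w) ↦ (z, w - β z)` decouples the two factors. -/
theorem integrable_and_jointEntropy_of_factor (hΓ : 0 < Γ) (a : ℂ) {β : ℂ → ℂ} (hβ : Continuous β)
    {H : ℂ → ℂ → ℝ} (hH : ∀ z w, H z w = gaussDensity Γ a z * gaussDensity 1 (β z) w) :
    Integrable (fun p : ℂ × ℂ => H p.1 p.2 * Real.log (H p.1 p.2)) ∧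
      jointEntropy H = 2 - Real.log Γ := by
  set F : ℂ × ℂ → ℝ := fun p =>
    gaussDensity Γ a p.1 * Real.log (gaussDensity Γ a p.1) * gaussDensity 1 0 p.2
      + gaussDensity Γ a p.1 * (gaussDensity 1 0 p.2 * Real.log (gaussDensity 1 0 p.2)) with hF
  have h1 := (integrable_gaussDensity_mul_log hΓ a).mul_prod
    (integrable_gaussDensity one_pos 0)
  have h2 := (integrable_gaussDensity hΓ a).mul_prod
    (integrable_gaussDensity_mul_log one_pos 0)
  have hFi : Integrable F (volume.prod volume) := h1.add h2
  have hFint : ∫ p, F p ∂(volume.prod volume) = Real.pi ^ 2 * (Real.log Γ - 2) := by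
    rw [hF, integral_add h1 h2,
      integral_prod_mul (fun z => gaussDensity Γ a z * Real.log (gaussDensity Γ a z)),
      integral_prod_mul (gaussDensity Γ a)
        (fun w => gaussDensity 1 0 w * Real.log (gaussDensity 1 0 w)),
      integral_gaussDensity_mul_log hΓ, integral_gaussDensity_mul_log one_pos,
      integral_gaussDensity hΓ, integral_gaussDensity one_pos, Real.log_one]
    ring
  have hΨ : MeasurePreserving (fun p : ℂ × ℂ => (p.1, p.2 - β p.1)) (volume.prod volume)
      (volume.prod volume) :=
    (MeasurePreserving.id volume).skew_product
      (g := fun z w => w - β z) (Continuous.measurable (by fun_prop))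
      (Filter.Eventually.of_forall fun z => (measurePreserving_sub_right volume (β z)).map_eq)
  -- the logarithm of the product splits, and `gaussDensity 1 (β z) w = gaussDensity 1 0 (w - β z)`
  have heq : (fun p : ℂ × ℂ => H p.1 p.2 * Real.log (H p.1 p.2))
      = F ∘ fun p : ℂ × ℂ => (p.1, p.2 - β p.1) := by
    have hpos : ∀ {b : ℝ} (_ : 0 < b) (a z : ℂ), gaussDensity b a z ≠ 0 := fun hb a z =>
      (mul_pos hb (Real.exp_pos _)).ne'
    have hshift : ∀ z w, gaussDensity 1 (β z) w = gaussDensity 1 0 (w - β z) := by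
      simp [gaussDensity]
    funext p
    rw [hH, Real.log_mul (hpos hΓ _ _) (hpos one_pos _ _), hshift]
    simp only [hF, Function.comp]
    ring
  constructor
  · rw [heq]
    exact hΨ.integrable_comp_of_integrable hFi
  · have hint : ∫ p : ℂ × ℂ, H p.1 p.2 * Real.log (H p.1 p.2) = Real.pi ^ 2 * (Real.log Γ - 2) := by
      rw [heq, ← hFint]
      have h3 := integral_map (μ := volume.prod volume) hΨ.measurable.aemeasurable
        (f := F) (by rw [hΨ.map_eq]; exact hFi.aestronglyMeasurable)
      rw [hΨ.map_eq] at h3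
      exact h3.symm
    rw [jointEntropy, integral_div, hint]
    field_simp
    ring

theorem integral_gaussDensity_mul_div_pi (c : ℝ) (b : ℂ) :
    ∫ w, c * gaussDensity 1 b w / Real.pi = c := by
  rw [integral_div, integral_const_mul, integral_gaussDensity one_pos]
  field_simp

/-- Completing the square in the second variable. -/
theorem husimi_gaussian_factor {M : ℝ} {τ u v : ℂ} (hΓ : 0 < Γ) (hτ : ‖τ‖ ^ 2 = 1 - Γ)
    (hM : M * Real.exp ((‖u‖ ^ 2 + ‖v‖ ^ 2 + 2 * (starRingEnd ℂ τ * u * v).re) * Γ⁻¹) = Γ)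
    (z w : ℂ) : M * Real.exp (-‖z‖ ^ 2 - ‖w‖ ^ 2 + 2 * (τ * (starRingEnd ℂ z * starRingEnd ℂ w)
      + u * starRingEnd ℂ z + v * starRingEnd ℂ w).re)
      = gaussDensity Γ ((u + τ * starRingEnd ℂ v) / Γ) z *
        gaussDensity 1 (τ * starRingEnd ℂ z + v) w := by
  rw [gaussDensity, gaussDensity, ← hM, mul_assoc M, one_mul, mul_assoc M, ← Real.exp_add,
    ← Real.exp_add, hM]
  congr 2
  have hscale : Γ * ‖z - (u + τ * starRingEnd ℂ v) / Γ‖ ^ 2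
      = ‖Γ * z - (u + τ * starRingEnd ℂ v)‖ ^ 2 / Γ := by
    have h : (Γ : ℂ) ≠ 0 := by exact_mod_cast hΓ.ne'
    have h' : (Γ : ℂ) * z - (u + τ * starRingEnd ℂ v)
        = Γ * (z - (u + τ * starRingEnd ℂ v) / Γ) := by field_simp
    rw [h', norm_mul, Complex.norm_real, Real.norm_eq_abs, mul_pow, sq_abs]
    field_simp
  rw [neg_mul, hscale]
  simp only [← Complex.normSq_eq_norm_sq, Complex.normSq_apply] at hτ ⊢
  simp only [Complex.add_re, Complex.sub_re, Complex.mul_re, Complex.add_im, Complex.sub_im,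
    Complex.mul_im, Complex.conj_re, Complex.conj_im, Complex.ofReal_re, Complex.ofReal_im]
  field_simp
  linear_combination (v.re * v.re + v.im * v.im + Γ * (z.re * z.re + z.im * z.im)) * hτ

end ParametricAmplifier

/-! ### Entropies and gain of the evolved state -/

namespace ParametricAmplifier

open MeasureTheory Filter

/-- The entropies of a normalized Gaussian Husimi function depend only on `Γ = 1 - |τ|²`. -/
theorem entropies_of_gaussian {M Γ : ℝ} {τ u v : ℂ} (hΓ : 0 < Γ) (hτ : ‖τ‖ ^ 2 = 1 - Γ)
    (hM : M * Real.exp ((‖u‖ ^ 2 + ‖v‖ ^ 2 + 2 * (starRingEnd ℂ τ * u * v).re) * Γ⁻¹) = Γ)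
    {H : ℂ → ℂ → ℝ} (hH : ∀ z w, H z w = M * Real.exp (-‖z‖ ^ 2 - ‖w‖ ^ 2
      + 2 * (τ * (starRingEnd ℂ z * starRingEnd ℂ w) + u * starRingEnd ℂ z
        + v * starRingEnd ℂ w).re)) :
    EntropiesConverge H ∧ jointEntropy H = 2 - Real.log Γ ∧
      modeEntropy (marginalA H) = 1 - Real.log Γ ∧
      modeEntropy (marginalB H) = 1 - Real.log Γ := by
  have hA : ∀ z w, H z w = gaussDensity Γ ((u + τ * starRingEnd ℂ v) / Γ) z *
      gaussDensity 1 (τ * starRingEnd ℂ z + v) w := fun z w => by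
    rw [hH, husimi_gaussian_factor hΓ hτ hM]
  have hB : ∀ z w, H z w = gaussDensity Γ ((v + τ * starRingEnd ℂ u) / Γ) w *
      gaussDensity 1 (τ * starRingEnd ℂ w + u) z := fun z w => by
    rw [hH, ← husimi_gaussian_factor (M := M) hΓ hτ
      (by rw [add_comm (‖v‖ ^ 2), mul_right_comm (starRingEnd ℂ τ)]; exact hM)]
    ring_nf
  have hmA : marginalA H = gaussDensity Γ ((u + τ * starRingEnd ℂ v) / Γ) := by
    funext z
    simp only [marginalA, hA, integral_gaussDensity_mul_div_pi]
  have hmB : marginalB H = gaussDensity Γ ((v + τ * starRingEnd ℂ u) / Γ) := by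
    funext w
    simp only [marginalB, hB, integral_gaussDensity_mul_div_pi]
  obtain ⟨hJi, hJ⟩ := integrable_and_jointEntropy_of_factor hΓ _
    (β := fun z => τ * starRingEnd ℂ z + v) (by fun_prop) hA
  refine ⟨⟨fun z => ?_, fun w => ?_, hJi, ?_, ?_⟩, hJ, ?_, ?_⟩
  · simp only [hA]
    exact (integrable_gaussDensity one_pos _).const_mul _
  · simp only [hB]
    exact (integrable_gaussDensity one_pos _).const_mul _
  · rw [hmA]
    exact integrable_gaussDensity_mul_log hΓ _
  · rw [hmB]
    exact integrable_gaussDensity_mul_log hΓ _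
  · rw [hmA, modeEntropy_gaussDensity hΓ]
  · rw [hmB, modeEntropy_gaussDensity hΓ]

theorem logGain_eq_ofReal_log {δ : ℝ} {κ φ : ℂ}
    (hφ : φ ^ 2 = ((‖κ‖ ^ 2 - (δ / 2) ^ 2 : ℝ) : ℂ)) (hφ0 : φ ≠ 0) (t : ℝ) :
    logGain κ φ t = (Real.log (‖gain δ φ t‖ ^ 2) : ℂ) := by
  rw [norm_gain_sq hφ hφ0, Complex.ofReal_log (by positivity), logGain]
  congr 1
  push_cast
  rw [ofReal_ampSinh hφ]
  ring

/-- Above threshold `φ` is real, and `|sinh x| ≥ |x|` makes the gain unbounded. -/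
theorem tendsto_norm_gain_sq {δ : ℝ} {κ φ : ℂ}
    (hφ : φ ^ 2 = ((‖κ‖ ^ 2 - (δ / 2) ^ 2 : ℝ) : ℂ)) (hφ0 : φ ≠ 0) (hδ : |δ| / 2 < ‖κ‖) :
    Tendsto (fun t => ‖gain δ φ t‖ ^ 2) atTop atTop := by
  have hκ : 0 < ‖κ‖ := lt_of_le_of_lt (by positivity) hδ
  have hr : 0 < ‖κ‖ ^ 2 - (δ / 2) ^ 2 := by
    have h : (δ / 2) ^ 2 = (|δ| / 2) ^ 2 := by rw [div_pow, div_pow, sq_abs]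
    rw [h, sub_pos]
    exact pow_lt_pow_left₀ hδ (by positivity) two_ne_zero
  obtain ⟨x, rfl⟩ : ∃ x : ℝ, φ = x := by
    rcases conj_eq_or_eq_neg_of_sq_eq_ofReal hφ with h | h
    · exact ⟨φ.re, (Complex.conj_eq_iff_re.1 h).symm⟩
    · have hre : φ.re = 0 := by
        have := congrArg Complex.re h
        simp at this
        linarith
      have h2 := congrArg Complex.re hφ
      rw [sq, Complex.mul_re, hre, Complex.ofReal_re] at h2
      nlinarith [mul_self_nonneg φ.im]
  have hx : x ≠ 0 := by exact_mod_cast hφ0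
  refine tendsto_atTop_mono' atTop (f₁ := fun t : ℝ => ‖κ‖ ^ 2 * t ^ 2) ?_
    ((tendsto_pow_atTop two_ne_zero).const_mul_atTop (by positivity))
  filter_upwards with t
  rw [norm_gain_sq hφ hφ0]
  have hS : ampSinh x t = Real.sinh (x * t) / x := by
    rw [ampSinh, ← Complex.ofReal_mul, ← Complex.ofReal_sinh, ← Complex.ofReal_div,
      Complex.ofReal_re]
  have hsinh : (x * t) ^ 2 ≤ Real.sinh (x * t) ^ 2 := by
    rw [sq_le_sq, Real.abs_sinh]
    exact Real.self_le_sinh_iff.2 (abs_nonneg _)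
  have ht : t ^ 2 ≤ ampSinh x t ^ 2 := by
    rw [hS, div_pow, le_div_iff₀ (by positivity)]
    linarith [mul_pow x t 2]
  nlinarith [mul_le_mul_of_nonneg_left ht (sq_nonneg ‖κ‖)]

end ParametricAmplifier

theorem mainTheorem4 (ωa ωb δ : ℝ) (κ ζa ζb φ : ℂ)
    (hφ : φ ^ 2 = ((‖κ‖ ^ 2 - (δ / 2) ^ 2 : ℝ) : ℂ)) (hφ0 : φ ≠ 0) :
    (∃! ψ : ℝ → ParametricAmplifier.Fock,
      ParametricAmplifier.IsEvolution ωa ωb δ κ (ParametricAmplifier.coherent ζa ζb) ψ) ∧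
    ∀ ψ : ℝ → ParametricAmplifier.Fock,
      ParametricAmplifier.IsEvolution ωa ωb δ κ (ParametricAmplifier.coherent ζa ζb) ψ →
      ∀ H : ℝ → ℂ → ℂ → ℝ,
        (∀ t, H t = ParametricAmplifier.husimi (ParametricAmplifier.pureState (ψ t))) →
        (∀ t : ℝ,
          ParametricAmplifier.EntropiesConverge (H t) ∧
          (ParametricAmplifier.jointEntropy (H t) : ℂ)
            = 2 + ParametricAmplifier.logGain κ φ t ∧
          (ParametricAmplifier.modeEntropy (ParametricAmplifier.marginalA (H t)) : ℂ)
            = 1 + ParametricAmplifier.logGain κ φ t ∧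
          (ParametricAmplifier.modeEntropy (ParametricAmplifier.marginalB (H t)) : ℂ)
            = 1 + ParametricAmplifier.logGain κ φ t ∧
          (ParametricAmplifier.correlation (H t) : ℂ)
            = ParametricAmplifier.logGain κ φ t / (1 + ParametricAmplifier.logGain κ φ t)) ∧
        ParametricAmplifier.correlation (H 0) = 0 ∧
        (|δ| / 2 < ‖κ‖ →
          Filter.Tendsto (fun t : ℝ => ParametricAmplifier.correlation (H t))
            Filter.atTop (nhds 1)) := by
  open ParametricAmplifier in
  have hev := isEvolution_evolved (ωa := ωa) (ωb := ωb) hφ hφ0 ζa ζb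
  refine ⟨⟨_, hev, fun χ hχ => hχ.unique hev⟩, fun ψ hψ H hH => ?_⟩
  obtain rfl := hψ.unique hev
  set L : ℝ → ℝ := fun t => Real.log (‖gain δ φ t‖ ^ 2) with hL
  have hgain : ∀ t, 1 ≤ ‖gain δ φ t‖ ^ 2 := fun t => by
    rw [norm_gain_sq hφ hφ0]
    exact le_add_of_nonneg_right (by positivity)
  have hL0 : ∀ t, 0 ≤ L t := fun t => Real.log_nonneg (hgain t)
  have hent : ∀ t, EntropiesConverge (H t) ∧ jointEntropy (H t) = 2 + L t ∧
      modeEntropy (marginalA (H t)) = 1 + L t ∧ modeEntropy (marginalB (H t)) = 1 + L t := by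
    intro t
    have h := entropies_of_gaussian (H := H t) (Γ := (‖gain δ φ t‖ ^ 2)⁻¹)
      (inv_pos.2 (one_pos.trans_le (hgain t)))
      (norm_squeeze_sq (ωa := ωa) (ωb := ωb) hφ hφ0 t)
      (by rw [inv_inv]; exact norm_prefactor_sq_mul_exp hφ hφ0 ζa ζb t)
      (fun z w => by rw [hH]; exact husimi_smul_gaussian _ (norm_squeeze_lt_one hφ hφ0 t) _ _ z w)
    simpa only [Real.log_inv, sub_neg_eq_add] using h
  have hcorr : ∀ t, correlation (H t) = L t / (1 + L t) := by
    intro t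
    obtain ⟨-, hJ, hA, hB⟩ := hent t
    have h1 : 1 + L t ≠ 0 := (add_pos_of_pos_of_nonneg one_pos (hL0 t)).ne'
    rw [correlation, hJ, hA, hB, ← two_mul]
    field_simp
    ring
  refine ⟨fun t => ?_, ?_, fun hδ => ?_⟩
  · obtain ⟨hE, hJ, hA, hB⟩ := hent t
    rw [logGain_eq_ofReal_log hφ hφ0, hJ, hA, hB, hcorr]
    exact ⟨hE, by push_cast; rfl, by push_cast; rfl, by push_cast; rfl, by push_cast; rfl⟩
  · have h0 : L 0 = 0 := by
      simp only [hL]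
      rw [norm_gain_sq hφ hφ0]
      simp [ampSinh]
    rw [hcorr, h0, zero_div]
  · have hT : Filter.Tendsto L Filter.atTop Filter.atTop :=
      Real.tendsto_log_atTop.comp (tendsto_norm_gain_sq hφ hφ0 hδ)
    have hinv : Filter.Tendsto (fun t => 1 - (1 + L t)⁻¹) Filter.atTop (nhds (1 - 0)) :=
      tendsto_const_nhds.sub
        (tendsto_inv_atTop_zero.comp (Filter.tendsto_atTop_add_const_left _ 1 hT))
    rw [sub_zero] at hinv
    refine hinv.congr fun t => ?_
    have h1 : 1 + L t ≠ 0 := (add_pos_of_pos_of_nonneg one_pos (hL0 t)).ne'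
    rw [hcorr]
    field_simp
    ring
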